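/- Let $N_n$ ($n\ge 0$) be the orthogonal projection of $\ell^2(\mathbb N)$ onto the span of the first $n$ standard basis vectors, let $\mathcal N=\{N_n : n\ge 0\}\cup\{I\}$, and let $\mathcal T(\mathbb N)$ be the algebra of all bounded operators on $\ell^2(\mathbb N)$ that leave the range of every $N\in\mathcal N$ invariant (the upper triangular operators). An interval of $\mathcal N$ is a projection $N-M$ with $M<N$ in $\mathcal N$. A (left) primitive ideal of $\mathcal T(\mathbb N)$ is the annihilator of a simple left $\mathcal T(\mathbb N)$-module. The diagonal ideals of $\mathcal T(\mathbb N)$ are the ideals $$\mathcal I_N^+=\Big\{X\in\mathcal T(\mathbb N):\inf_{M\in\mathcal N,\,M>N}\|(M-N)X(M-N)\|=0\Big\}\ (N<I),\qquad \mathcal I_N^-=\Big\{X\in\mathcal T(\mathbb N):\inf_{M\in\mathcal N,\,M<N}\|(N-M)X(N-M)\|=0\Big\}\ (N>0),$$ where $N\in\mathcal N$. **Theorem.** Let $P$ be a primitive ideal of $\mathcal T(\mathbb N)$ that is neither a diagonal ideal nor a maximal two-sided ideal. Then there are a free ultrafilter $\mathcal U$ on $\mathbb N$ and a sequence $(E_i)_{i\in\mathbb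 N}$ of pairwise orthogonal finite-rank intervals of $\mathcal N$ such that $$\lim_{i\to\mathcal U}\operatorname{rk}E_i=+\infty\qquad\text{and}\qquad P\supseteq\Big\{X\in\mathcal T(\mathbb N):\lim_{i\to\mathcal U}\|E_iXE_i\|=0\Big\}.\tag{$*$}$$ Moreover, let $\mathcal U$ be any free ultrafilter and $(E_i)$ any sequence of pairwise orthogonal projections, each of them zero or a finite-rank interval of $\mathcal N$, for which $(*)$ holds. If $E_i=E_i^0+E_i^1$ for every $i$, where each of $E_i^0$, $E_i^1$ is zero or an interval of $\mathcal N$, then for at least one $j\in\{0,1\}$ the sequence $(E_i^j)$ again consists of pairwise orthogonal projections, each of them zero or a finite-rank interval of $\mathcal N$, and $(*)$ holds for it with the same $\mathcal U$: $$\lim_{i\to\mathcal U}\operatorname{rk}E_i^j=+\infty\qquad\text{and}\qquad P\supseteq\Big\{X\in\mathcal T(\mathbb N):\lim_{i\to\mathcal U}\|E_i^jXE_i^j\|=0\Big\}.$$ -/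

import Mathlib

open Filter Topology

namespace NestAlg

noncomputable section

universe u

section General

variable {H : Type*} [NormedAddCommGroup H] [InnerProductSpace ℂ H]

/-- The nest algebra of a set `𝒩` of projections: the bounded operators that leave invariant
the range of every member of `𝒩`. -/
def nestAlgebra (𝒩 : Set (H →L[ℂ] H)) : Subalgebra ℂ (H →L[ℂ] H) where
  carrier := {X | ∀ N ∈ 𝒩, ∀ x ∈ N.range, X x ∈ N.range}
  mul_mem' := fun hX hY N hN x hx => hX N hN _ (hY N hN x hx)
  add_mem' := fun hX hY N hN x hx => N.range.add_mem (hX N hN x hx) (hY N hN x hx)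
  algebraMap_mem' := fun c N _ x hx => by
    simpa [Algebra.algebraMap_eq_smul_one] using N.range.smul_mem c hx

/-- An interval of `𝒩`: a difference `N - M` with `M < N` in `𝒩`
(`<` is the usual order on self-adjoint operators). -/
def IsInterval (𝒩 : Set (H →L[ℂ] H)) (E : H →L[ℂ] H) : Prop :=
  ∃ M ∈ 𝒩, ∃ N ∈ 𝒩, M < N ∧ E = N - M

/-- The diagonal seminorm `i⁺_N(X) = inf {‖(M - N) X (M - N)‖ : M > N in 𝒩}`. -/
def diagSeminormPlus (𝒩 : Set (H →L[ℂ] H)) (N X : H →L[ℂ] H) : ℝ :=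
  sInf {r : ℝ | ∃ M ∈ 𝒩, N < M ∧ r = ‖(M - N) * X * (M - N)‖}

/-- The diagonal seminorm `i⁻_N(X) = inf {‖(N - M) X (N - M)‖ : M < N in 𝒩}`. -/
def diagSeminormMinus (𝒩 : Set (H →L[ℂ] H)) (N X : H →L[ℂ] H) : ℝ :=
  sInf {r : ℝ | ∃ M ∈ 𝒩, M < N ∧ r = ‖(N - M) * X * (N - M)‖}

/-- The ideal `P` of the nest algebra is one of the diagonal ideals
`I⁺_N = {X : i⁺_N(X) = 0}` (`N < I` in `𝒩`) or `I⁻_N = {X : i⁻_N(X) = 0}` (`N > 0` in `𝒩`). -/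
def IsDiagonalIdeal (𝒩 : Set (H →L[ℂ] H)) (P : TwoSidedIdeal (nestAlgebra 𝒩)) : Prop :=
  (∃ N ∈ 𝒩, N < 1 ∧ ∀ X : nestAlgebra 𝒩, X ∈ P ↔ diagSeminormPlus 𝒩 N X = 0) ∨
  (∃ N ∈ 𝒩, 0 < N ∧ ∀ X : nestAlgebra 𝒩, X ∈ P ↔ diagSeminormMinus 𝒩 N X = 0)

/-- `P` contains the set `{X : lim_𝒰 ‖E_i X E_i‖ = 0}`, where the `E_i` are pairwise orthogonal,
each of them is zero or an interval of finite rank, and `lim_𝒰 rk E_i = ∞`. -/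
structure ContainsLimitIdeal (𝒩 : Set (H →L[ℂ] H)) (P : TwoSidedIdeal (nestAlgebra 𝒩))
    (𝒰 : Ultrafilter ℕ) (E : ℕ → H →L[ℂ] H) : Prop where
  interval_or_zero : ∀ i, IsInterval 𝒩 (E i) ∨ E i = 0
  finite_rank : ∀ i, FiniteDimensional ℂ (E i).range
  orthogonal : Pairwise fun i j => E i * E j = 0
  rank_tendsto : Tendsto (fun i => Module.finrank ℂ (E i).range) (𝒰 : Filter ℕ) atTop
  contains : ∀ X : nestAlgebra 𝒩,
    Tendsto (fun i => ‖E i * (X : H →L[ℂ] H) * E i‖) (𝒰 : Filter ℕ) (𝓝 0) → X ∈ P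

end General

/-- A (left) primitive ideal of a ring: the annihilator of a simple left module.
(Every simple module is a quotient of `A`, so modules in the universe of `A` suffice.) -/
def IsPrimitiveIdeal {A : Type u} [Ring A] (P : TwoSidedIdeal A) : Prop :=
  ∃ (V : Type u) (_ : AddCommGroup V) (_ : Module A V), IsSimpleModule A V ∧
    ∀ a : A, a ∈ P ↔ ∀ v : V, a • v = 0

/-- The Hilbert space `ℓ²(ℕ)`. -/
abbrev Ell2 : Type := lp (fun _ : ℕ => ℂ) 2

/-- The span of the first `n` standard basis vectors of `ℓ²(ℕ)`. -/
def initialSpan (n : ℕ) : Submodule ℂ Ell2 :=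
  Submodule.span ℂ (Set.range fun i : Fin n => (lp.single 2 (i : ℕ) (1 : ℂ) : Ell2))

instance initialSpan_finiteDimensional (n : ℕ) : FiniteDimensional ℂ (initialSpan n) :=
  FiniteDimensional.span_of_finite ℂ (Set.finite_range _)

/-- The canonical nest `{N_n : n ∈ ℕ} ∪ {I}` on `ℓ²(ℕ)`, where `N_n` is the orthogonal
projection onto the span of the first `n` basis vectors (so `N_0 = 0`). -/
def canonicalNest : Set (Ell2 →L[ℂ] Ell2) :=
  Set.range (fun n : ℕ => (initialSpan n).starProjection) ∪ {1}

/-- The algebra `T(ℕ)` of infinite upper triangular operators. -/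
abbrev upperTriangular : Subalgebra ℂ (Ell2 →L[ℂ] Ell2) := nestAlgebra canonicalNest

end

end NestAlg

/-! A primitive ideal `P` is prime (`IsPrimitiveIdeal.mem_or_mem`,
`IsPrimitiveIdeal.subset_or_subset`) and norm closed (`IsPrimitiveIdeal.mem_of_forall_norm_lt`);
apart from the maximality criterion for commutative quotients, nothing else about simple modules is
used.

Existence. If a rank-one diagonal projection lay outside `P`, then `P` would be the ideal of
operators whose corresponding diagonal entry vanishes, which is diagonal. So `P` contains all finite
coordinate projections, and, being different from the diagonal ideal at infinity, it contains some
`X` whose tails stay bounded below in norm. Compressing `X` to suitable vectors in successive blocks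
gives `B = U X W` close to the identity. The factor `W` need not be upper triangular, but `W Z` is
for every `Z` supported far enough above the diagonal; hence `P` contains all such operators
(`exists_gap`). A product of two strictly block upper triangular operators has this large gap when
the blocks grow fast, so primeness puts all strictly block upper triangular operators in `P`
(`exists_blocks`). Modulo these, `P` sees only the block diagonal, and primeness makes the sets of
decisive blocks an ultrafilter (`exists_ultrafilter`). Norm closedness upgrades vanishing blocks to
blocks whose norms tend to zero.

Ranks. If the ranks did not tend to infinity, the ultrafilter would select intervals of bounded
length. There the strictly upper triangular part is nilpotent, so primeness forces all commutators
into `P`, and `P` is maximal (`isCoatom_of_bounded`).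

Splitting. If an interval is cut into a lower part 0 and an upper part 1, the product of an operator
with zero block on part 0 and one with zero block on part 1 compresses to zero on the interval. The
norm version of this and primeness give the alternative (`limit_subset_or_subset`). -/

namespace NestAlg

/-! ### Primeness and maximality of primitive ideals -/

section Ring

universe u

variable {A : Type u} [Ring A] {P : TwoSidedIdeal A}

theorem IsPrimitiveIdeal.one_notMem (hP : IsPrimitiveIdeal P) : (1 : A) ∉ P := by
  obtain ⟨V, _, _, hV, h⟩ := hP
  intro h1
  have := IsSimpleModule.nontrivial A V
  obtain ⟨v, hv⟩ := exists_ne (0 : V)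
  exact hv (by simpa using (h 1).1 h1 v)

theorem IsPrimitiveIdeal.mem_or_mem (hP : IsPrimitiveIdeal P) {a b : A}
    (hab : ∀ c, a * c * b ∈ P) : a ∈ P ∨ b ∈ P := by
  obtain ⟨V, _, _, hV, h⟩ := hP
  by_contra! hcon
  obtain ⟨ha, hb⟩ := hcon
  rw [h] at ha hb
  push Not at ha hb
  obtain ⟨w, hw⟩ := ha
  obtain ⟨v, hv⟩ := hb
  obtain ⟨c, hc⟩ := IsSimpleModule.toSpanSingleton_surjective A hv w
  refine hw ?_
  rw [← hc, LinearMap.toSpanSingleton_apply, ← mul_smul, ← mul_smul]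
  exact (h _).1 (hab c) v

/-- If the products from a set `J` and a set `K` closed under left multiplication lie in a
primitive ideal, then one of the two sets lies in it. -/
theorem IsPrimitiveIdeal.subset_or_subset (hP : IsPrimitiveIdeal P) {J K : A → Prop}
    (hK : ∀ c b, K b → K (c * b)) (h : ∀ a b, J a → K b → a * b ∈ P) :
    (∀ a, J a → a ∈ P) ∨ (∀ b, K b → b ∈ P) := by
  by_contra! hcon
  obtain ⟨⟨a, ha, haP⟩, b, hb, hbP⟩ := hcon
  rcases hP.mem_or_mem (a := a) (b := b) (fun c => by
    rw [mul_assoc]; exact h _ _ ha (hK c b hb)) with h | h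
  exacts [haP h, hbP h]

/-- A commutative primitive ring is a field: if `b * q` fixes a nonzero vector `v`, then `1 - b * q`
kills `v`, and since it is central modulo `P` it kills the whole cyclic module generated by `v`. -/
theorem IsPrimitiveIdeal.isCoatom_of_commutator_mem (hP : IsPrimitiveIdeal P)
    (hcomm : ∀ a b : A, a * b - b * a ∈ P) : IsCoatom P := by
  have h1 := hP.one_notMem
  refine ⟨fun h => h1 (h ▸ trivial), fun Q hQ => ?_⟩
  obtain ⟨q, hqQ, hqP⟩ := Set.exists_of_ssubset (show (P : Set A) ⊂ Q from hQ)
  obtain ⟨V, _, _, hV, h⟩ := hP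
  have hqP' : ¬ ∀ v : V, q • v = 0 := fun H => hqP ((h q).2 H)
  push Not at hqP'
  obtain ⟨v, hv⟩ := hqP'
  have hv0 : v ≠ 0 := by rintro rfl; simp at hv
  obtain ⟨b, hb⟩ := IsSimpleModule.toSpanSingleton_surjective A hv v
  rw [LinearMap.toSpanSingleton_apply, ← mul_smul] at hb
  have hmem : 1 - b * q ∈ P := by
    rw [h]
    intro w
    obtain ⟨c, rfl⟩ := IsSimpleModule.toSpanSingleton_surjective A hv0 w
    rw [LinearMap.toSpanSingleton_apply]
    have h2 := (h _).1 (hcomm (1 - b * q) c) v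
    have h3 : (1 - b * q) • v = 0 := by rw [sub_smul, hb, one_smul, sub_self]
    rw [sub_smul, mul_smul, mul_smul c, h3, smul_zero, sub_zero] at h2
    exact h2
  rw [← TwoSidedIdeal.one_mem_iff]
  have := Q.add_mem (hQ.le hmem) (Q.mul_mem_left b q hqQ)
  simpa using this

end Ring

/-- Primitive ideals of a Banach algebra are norm closed. -/
theorem IsPrimitiveIdeal.mem_of_forall_norm_lt {A : Type*} [NormedRing A] [CompleteSpace A]
    {P : TwoSidedIdeal A} (hP : IsPrimitiveIdeal P) {x : A}
    (hx : ∀ ε > 0, ∃ y ∈ P, ‖x - y‖ < ε) : x ∈ P := by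
  obtain ⟨V, _, _, hV, h⟩ := hP
  rw [h]
  by_contra! hcon
  obtain ⟨v, hv⟩ := hcon
  obtain ⟨a, ha⟩ := IsSimpleModule.toSpanSingleton_surjective A hv v
  rw [LinearMap.toSpanSingleton_apply, ← mul_smul] at ha
  -- Since `a * x` fixes `v` and `y` annihilates it, `1 - a * (x - y)` kills `v`; closeness of `y`
  -- to `x` makes this element invertible.
  obtain ⟨y, hyP, hy⟩ := hx (1 / (‖a‖ + 1)) (by positivity)
  have hlt : ‖a * (x - y)‖ < 1 := by
    have h0 : 0 < ‖a‖ + 1 := by positivity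
    rw [lt_div_iff₀ h0] at hy
    nlinarith [norm_mul_le a (x - y), norm_nonneg (x - y), norm_nonneg a]
  have h1 : (Units.oneSub _ hlt : A) • v = 0 := by
    rw [Units.val_oneSub, mul_sub, sub_smul, sub_smul, ha, mul_smul, (h y).1 hyP v]
    simp
  have h2 : v = 0 := by
    rw [← one_smul A v, ← Units.inv_mul (Units.oneSub _ hlt), mul_smul, h1, smul_zero]
  exact hv (by rw [h2, smul_zero])

/-! ### Coordinate projections and block operators on `ℓ²(ℕ)` -/

section Coordinates

theorem sum_sq_le_norm_sq (x : Ell2) (s : Finset ℕ) : ∑ k ∈ s, ‖x k‖ ^ 2 ≤ ‖x‖ ^ 2 := by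
  simpa using lp.sum_rpow_le_norm_rpow (p := 2) (by simp) x s

theorem norm_le_of_sum_sq_le {x : Ell2} {C : ℝ} (hC : 0 ≤ C)
    (h : ∀ s : Finset ℕ, ∑ k ∈ s, ‖x k‖ ^ 2 ≤ C ^ 2) : ‖x‖ ≤ C :=
  lp.norm_le_of_forall_sum_le (p := 2) (by simp) hC (by simpa using h)

theorem hasSum_norm_sq (x : Ell2) : HasSum (fun k => ‖x k‖ ^ 2) (‖x‖ ^ 2) := by
  simpa using lp.hasSum_norm (p := 2) (by simp) x

theorem norm_apply_le (x : Ell2) (k : ℕ) : ‖x k‖ ≤ ‖x‖ :=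
  lp.norm_apply_le_norm (by simp) x k

/-- A linear map on sequences with square-summable values defines a bounded operator. -/
theorem exists_operator {C : ℝ} (hC : 0 ≤ C) (f : Ell2 →ₗ[ℂ] (ℕ → ℂ))
    (hf : ∀ x (s : Finset ℕ), ∑ k ∈ s, ‖f x k‖ ^ 2 ≤ (C * ‖x‖) ^ 2) :
    ∃ B : Ell2 →L[ℂ] Ell2, ‖B‖ ≤ C ∧ ∀ x k, B x k = f x k := by
  have hmem : ∀ x, Memℓp (f x) 2 := fun x =>
    memℓp_gen' (C := (C * ‖x‖) ^ 2) (by simpa using hf x)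
  let g : Ell2 →ₗ[ℂ] Ell2 :=
    { toFun := fun x => ⟨f x, hmem x⟩
      map_add' := fun x y => by ext k; simp; rfl
      map_smul' := fun c x => by ext k; simp }
  have hg : ∀ x, ‖g x‖ ≤ C * ‖x‖ := fun x => norm_le_of_sum_sq_le (by positivity) (hf x)
  exact ⟨g.mkContinuous C hg, g.mkContinuous_norm_le hC hg, fun x k => rfl⟩

open Classical in
theorem exists_proj (S : Set ℕ) :
    ∃ B : Ell2 →L[ℂ] Ell2, ‖B‖ ≤ 1 ∧ ∀ x k, B x k = if k ∈ S then x k else 0 := by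
  refine exists_operator zero_le_one
    { toFun := fun x k => if k ∈ S then x k else 0
      map_add' := fun x y => by ext k; by_cases h : k ∈ S <;> simp [h]
      map_smul' := fun c x => by ext k; by_cases h : k ∈ S <;> simp [h] } fun x s => ?_
  rw [one_mul]
  refine le_trans (Finset.sum_le_sum fun k _ => ?_) (sum_sq_le_norm_sq x s)
  by_cases h : k ∈ S <;> simp [h]

/-- The coordinate projection of `ℓ²(ℕ)` onto the sequences supported in `S`. -/
noncomputable def proj (S : Set ℕ) : Ell2 →L[ℂ] Ell2 := (exists_proj S).choose

theorem norm_proj_le (S : Set ℕ) : ‖proj S‖ ≤ 1 := (exists_proj S).choose_spec.1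

open Classical in
theorem proj_apply (S : Set ℕ) (x : Ell2) (k : ℕ) : proj S x k = if k ∈ S then x k else 0 :=
  (exists_proj S).choose_spec.2 x k

theorem proj_apply_of_mem {S : Set ℕ} {k : ℕ} (h : k ∈ S) (x : Ell2) : proj S x k = x k := by
  rw [proj_apply, if_pos h]

theorem proj_apply_of_notMem {S : Set ℕ} {k : ℕ} (h : k ∉ S) (x : Ell2) : proj S x k = 0 := by
  rw [proj_apply, if_neg h]

theorem norm_proj_apply_le (S : Set ℕ) (x : Ell2) : ‖proj S x‖ ≤ ‖x‖ := by
  simpa using (proj S).le_of_opNorm_le (norm_proj_le S) x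

theorem ext_coord {X Y : Ell2 →L[ℂ] Ell2} (h : ∀ x k, X x k = Y x k) : X = Y :=
  ContinuousLinearMap.ext fun x => lp.ext (funext (h x))

theorem proj_mul_proj (S T : Set ℕ) : proj S * proj T = proj (S ∩ T) := by
  refine ext_coord fun x k => ?_
  rw [mul_apply_eq_comp]
  by_cases hS : k ∈ S <;> by_cases hT : k ∈ T <;> simp [proj_apply, hS, hT]

theorem proj_empty : proj ∅ = 0 := ext_coord fun x k => by simp [proj_apply]

theorem proj_univ : proj Set.univ = 1 := ext_coord fun x k => by simp [proj_apply]

theorem proj_sub_proj {S T : Set ℕ} (h : S ⊆ T) : proj T - proj S = proj (T \ S) := by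
  refine ext_coord fun x k => ?_
  by_cases hS : k ∈ S
  · simp [proj_apply, hS, h hS]
  · by_cases hT : k ∈ T <;> simp [proj_apply, hS, hT]

theorem proj_eq_self {S : Set ℕ} {x : Ell2} (h : ∀ k, k ∉ S → x k = 0) : proj S x = x := by
  refine lp.ext (funext fun k => ?_)
  by_cases hS : k ∈ S
  · exact proj_apply_of_mem hS x
  · rw [proj_apply_of_notMem hS, h k hS]

theorem sum_norm_proj_sq_le (α : ℕ → ℕ) (x : Ell2) (t : Finset ℕ) :
    ∑ i ∈ t, ‖proj (α ⁻¹' {i}) x‖ ^ 2 ≤ ‖x‖ ^ 2 := by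
  refine hasSum_le (fun k => ?_) (hasSum_sum fun i _ => hasSum_norm_sq (proj (α ⁻¹' {i}) x))
    (hasSum_norm_sq x)
  by_cases hk : α k ∈ t
  · rw [Finset.sum_eq_single_of_mem (α k) hk, proj_apply_of_mem (show k ∈ α ⁻¹' {α k} from rfl)]
    intro i _ hi
    rw [proj_apply_of_notMem (by simpa using hi.symm)]
    simp
  · rw [Finset.sum_eq_zero]
    · positivity
    · intro i hi
      rw [proj_apply_of_notMem (by rintro rfl; exact hk hi)]
      simp

/-- A uniformly bounded sequence of operators, compressed to map the `i`-th fibre of `α` to the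
`i`-th fibre of `β`, assembles to a bounded operator. -/
theorem exists_blockOp (α β : ℕ → ℕ) {C : ℝ} (hC : 0 ≤ C) (T : ℕ → Ell2 →L[ℂ] Ell2)
    (hT : ∀ i, ‖T i‖ ≤ C) :
    ∃ B : Ell2 →L[ℂ] Ell2, ‖B‖ ≤ C ∧
      ∀ x k, B x k = T (β k) (proj (α ⁻¹' {β k}) x) k := by
  refine exists_operator hC
    { toFun := fun x k => T (β k) (proj (α ⁻¹' {β k}) x) k
      map_add' := fun x y => by ext k; simp
      map_smul' := fun c x => by ext k; simp } fun x s => ?_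
  change ∑ k ∈ s, ‖T (β k) (proj (α ⁻¹' {β k}) x) k‖ ^ 2 ≤ _
  -- Different fibres of `β` read disjoint pieces of `x`, so the bound for each single block
  -- survives summation of squares.
  rw [← Finset.sum_fiberwise_of_maps_to (g := β) (t := s.image β)
    (fun k hk => Finset.mem_image_of_mem β hk)]
  calc _ ≤ ∑ i ∈ s.image β, C ^ 2 * ‖proj (α ⁻¹' {i}) x‖ ^ 2 := by
        refine Finset.sum_le_sum fun i _ => ?_
        rw [← mul_pow]
        calc _ = ∑ k ∈ s with β k = i, ‖T i (proj (α ⁻¹' {i}) x) k‖ ^ 2 := by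
              refine Finset.sum_congr rfl fun k hk => ?_
              rw [(Finset.mem_filter.1 hk).2]
          _ ≤ _ := (sum_sq_le_norm_sq _ _).trans (by
              gcongr
              exact (T i).le_of_opNorm_le (hT i) _)
    _ ≤ (C * ‖x‖) ^ 2 := by
        rw [← Finset.mul_sum, mul_pow]
        gcongr
        exact sum_norm_proj_sq_le α x _

end Coordinates

/-! ### Intervals of the nest as subsets of `ℕ`, and matrix entries -/

section Nest

theorem mem_initialSpan {n : ℕ} {x : Ell2} : x ∈ initialSpan n ↔ ∀ k, n ≤ k → x k = 0 := by
  constructor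
  · intro hx k hk
    induction hx using Submodule.span_induction with
    | mem x hx =>
      obtain ⟨i, rfl⟩ := hx
      exact lp.single_apply_ne 2 _ _ (by have := i.2; omega)
    | zero => rfl
    | add x y _ _ hx hy => simp [hx, hy]
    | smul c x _ hx => simp [hx]
  · intro hx
    have h1 := lp.hasSum_single (p := 2) (by simp) x
    have h2 := hasSum_sum_of_ne_finset_zero (L := .unconditional ℕ) (s := Finset.range n)
      (f := fun i => lp.single (E := fun _ : ℕ => ℂ) 2 i (x i)) fun k hk => by
        rw [hx k (by simpa using hk), lp.single_zero]
    rw [h1.unique h2]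
    refine Submodule.sum_mem _ fun i hi => ?_
    have : lp.single (E := fun _ : ℕ => ℂ) 2 i (x i) = x i • lp.single 2 i (1 : ℂ) := by
      rw [← lp.single_smul]; simp
    rw [this]
    exact Submodule.smul_mem _ _ (Submodule.subset_span ⟨⟨i, Finset.mem_range.1 hi⟩, rfl⟩)

theorem starProjection_initialSpan (n : ℕ) :
    (initialSpan n).starProjection = proj (Set.Iio n) := by
  refine ContinuousLinearMap.ext fun x => ?_
  refine Submodule.eq_starProjection_of_mem_of_inner_eq_zero (mem_initialSpan.2 fun k hk =>
    proj_apply_of_notMem (by simpa using hk) x) fun w hw => ?_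
  rw [lp.inner_eq_tsum]
  refine (tsum_congr fun k => ?_).trans tsum_zero
  by_cases hk : k < n
  · simp [proj_apply_of_mem (show k ∈ Set.Iio n from hk)]
  · simp [mem_initialSpan.1 hw k (not_lt.1 hk)]

theorem mem_canonicalNest {N : Ell2 →L[ℂ] Ell2} :
    N ∈ canonicalNest ↔ (∃ n, N = proj (Set.Iio n)) ∨ N = 1 := by
  simp only [canonicalNest, starProjection_initialSpan, Set.mem_union, Set.mem_range,
    Set.mem_singleton_iff, eq_comm]

theorem mem_range_proj {S : Set ℕ} {x : Ell2} : x ∈ (proj S).range ↔ ∀ k, k ∉ S → x k = 0 := by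
  constructor
  · rintro ⟨y, rfl⟩ k hk
    exact proj_apply_of_notMem hk y
  · intro h
    exact ⟨x, proj_eq_self h⟩

theorem mem_upperTriangular {X : Ell2 →L[ℂ] Ell2} : X ∈ upperTriangular ↔
    ∀ n, ∀ x : Ell2, (∀ k, n ≤ k → x k = 0) → ∀ k, n ≤ k → X x k = 0 := by
  constructor
  · intro h n x hx k hk
    exact mem_range_proj.1 (h (proj (Set.Iio n)) (mem_canonicalNest.2 (Or.inl ⟨n, rfl⟩)) x
      (mem_range_proj.2 fun k hk => hx k (by simpa using hk))) k (by simpa using hk)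
  · intro h N hN x hx
    rcases mem_canonicalNest.1 hN with ⟨n, rfl⟩ | rfl
    · exact mem_range_proj.2 fun k hk => h n x
        (fun k hk => mem_range_proj.1 hx k (by simpa using hk)) k (by simpa using hk)
    · exact ⟨X x, rfl⟩

/-- The matrix entries of an operator on `ℓ²(ℕ)`. -/
noncomputable def entry (X : Ell2 →L[ℂ] Ell2) (i j : ℕ) : ℂ := X (lp.single 2 j (1 : ℂ)) i

theorem eq_sum_single {n : ℕ} {x : Ell2} (hx : ∀ k, n ≤ k → x k = 0) :
    x = ∑ j ∈ Finset.range n, x j • (lp.single 2 j (1 : ℂ) : Ell2) := by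
  refine lp.ext (funext fun k => ?_)
  rw [lp.coeFn_sum, Finset.sum_apply]
  by_cases hk : k < n
  · rw [Finset.sum_eq_single_of_mem k (Finset.mem_range.2 hk)]
    · simp
    · intro j _ hj
      rw [lp.coeFn_smul, Pi.smul_apply, lp.single_apply_ne _ _ _ hj.symm, smul_zero]
  · rw [hx k (not_lt.1 hk), Finset.sum_eq_zero]
    intro j hj
    have := Finset.mem_range.1 hj
    rw [lp.coeFn_smul, Pi.smul_apply, lp.single_apply_ne _ _ _ (by omega), smul_zero]

theorem apply_eq_sum_entry (X : Ell2 →L[ℂ] Ell2) {n : ℕ} {x : Ell2}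
    (hx : ∀ k, n ≤ k → x k = 0) (i : ℕ) :
    X x i = ∑ j ∈ Finset.range n, x j * entry X i j := by
  conv_lhs => rw [eq_sum_single hx]
  rw [map_sum, lp.coeFn_sum, Finset.sum_apply]
  refine Finset.sum_congr rfl fun j _ => ?_
  rw [map_smul, lp.coeFn_smul, Pi.smul_apply, smul_eq_mul, entry]

theorem mem_upperTriangular_iff_entry {X : Ell2 →L[ℂ] Ell2} :
    X ∈ upperTriangular ↔ ∀ i j, j < i → entry X i j = 0 := by
  rw [mem_upperTriangular]
  constructor
  · intro h i j hij
    exact h (j + 1) _ (fun k hk => lp.single_apply_ne 2 _ _ (by omega)) i hij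
  · intro h n x hx k hk
    rw [apply_eq_sum_entry X hx]
    refine Finset.sum_eq_zero fun j hj => ?_
    rw [h k j (by have := Finset.mem_range.1 hj; omega), mul_zero]

theorem ext_entry {X Y : Ell2 →L[ℂ] Ell2} (h : ∀ i j, entry X i j = entry Y i j) : X = Y := by
  refine ContinuousLinearMap.ext fun x => ?_
  have h1 := lp.hasSum_single (p := 2) (by simp) x
  refine (X.hasSum h1).unique ?_
  convert Y.hasSum h1 using 2 with j
  have : lp.single (E := fun _ : ℕ => ℂ) 2 j (x j) = x j • lp.single 2 j (1 : ℂ) := by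
    rw [← lp.single_smul]; simp
  rw [this, map_smul, map_smul]
  congr 1
  exact lp.ext (funext fun i => h i j)

theorem entry_mul (X : Ell2 →L[ℂ] Ell2) {Y : Ell2 →L[ℂ] Ell2} (hY : Y ∈ upperTriangular)
    (i j : ℕ) :
    entry (X * Y) i j = ∑ k ∈ Finset.range (j + 1), entry Y k j * entry X i k := by
  rw [entry, mul_apply_eq_comp, apply_eq_sum_entry X (n := j + 1)]
  · rfl
  · intro k hk
    exact mem_upperTriangular_iff_entry.1 hY k j hk

/-- The workhorse for every support argument: triangularity of `Y` makes the entry of the product a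
finite sum, so zero patterns can be checked one middle index at a time. -/
theorem entry_mul_eq_zero {X Y : Ell2 →L[ℂ] Ell2} (hY : Y ∈ upperTriangular) {i j : ℕ}
    (h : ∀ k, k ≤ j → entry X i k = 0 ∨ entry Y k j = 0) : entry (X * Y) i j = 0 := by
  rw [entry_mul X hY]
  refine Finset.sum_eq_zero fun k hk => ?_
  rcases h k (by simpa [Nat.lt_succ_iff] using hk) with h | h <;> simp [h]

theorem entry_mul_diag {X Y : Ell2 →L[ℂ] Ell2} (hX : X ∈ upperTriangular)
    (hY : Y ∈ upperTriangular) (i : ℕ) :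
    entry (X * Y) i i = entry X i i * entry Y i i := by
  rw [entry_mul X hY, Finset.sum_eq_single_of_mem i (by simp), mul_comm]
  intro k hk hki
  have : k < i + 1 := Finset.mem_range.1 hk
  rw [mem_upperTriangular_iff_entry.1 hX i k (by omega), mul_zero]

theorem entry_sub (X Y : Ell2 →L[ℂ] Ell2) (i j : ℕ) :
    entry (X - Y) i j = entry X i j - entry Y i j := by
  simp [entry]

open Classical in
theorem proj_single (S : Set ℕ) (j : ℕ) :
    proj S (lp.single 2 j (1 : ℂ)) = if j ∈ S then (lp.single 2 j (1 : ℂ) : Ell2) else 0 := by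
  refine lp.ext (funext fun k => ?_)
  by_cases hkj : k = j
  · subst hkj
    by_cases hk : k ∈ S <;> simp [proj_apply, hk]
  · by_cases hk : k ∈ S <;> by_cases hj : j ∈ S <;>
      simp [proj_apply, hk, hj, Pi.single_eq_of_ne hkj]

open Classical in
theorem entry_compress (S T : Set ℕ) (X : Ell2 →L[ℂ] Ell2) (i j : ℕ) :
    entry (proj S * X * proj T) i j = if i ∈ S ∧ j ∈ T then entry X i j else 0 := by
  rw [entry, mul_apply_eq_comp, mul_apply_eq_comp, proj_single]
  by_cases hi : i ∈ S <;> by_cases hj : j ∈ T <;> simp [hi, hj, proj_apply, entry]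

open Classical in
theorem entry_proj (S : Set ℕ) (i j : ℕ) :
    entry (proj S) i j = if i = j ∧ i ∈ S then 1 else 0 := by
  rw [entry, proj_apply]
  by_cases hij : i = j
  · subst hij; simp
  · simp [hij]

theorem proj_mem (S : Set ℕ) : proj S ∈ upperTriangular :=
  mem_upperTriangular_iff_entry.2 fun i j h => by
    rw [entry_proj, if_neg (fun h' => h.ne' h'.1)]

theorem norm_entry_le (X : Ell2 →L[ℂ] Ell2) (i j : ℕ) : ‖entry X i j‖ ≤ ‖X‖ :=
  (norm_apply_le _ _).trans ((X.le_opNorm _).trans (by simp [lp.norm_single]))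

theorem norm_compress_le (S T : Set ℕ) (X : Ell2 →L[ℂ] Ell2) : ‖proj S * X * proj T‖ ≤ ‖X‖ := by
  have h1 := norm_mul_le (proj S * X) (proj T)
  have h2 := norm_mul_le (proj S) X
  nlinarith [norm_nonneg (proj S), norm_nonneg (proj T), norm_nonneg X, norm_proj_le S,
    norm_proj_le T, norm_nonneg (proj S * X)]

theorem subset_of_proj_le {S T : Set ℕ} (h : proj S ≤ proj T) : S ⊆ T := by
  intro k hk
  by_contra hkT
  have h1 := ((ContinuousLinearMap.le_def _ _).1 h).re_inner_nonneg_right (lp.single 2 k (1 : ℂ))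
  rw [lp.inner_single_left] at h1
  simp [proj_apply, hk, hkT] at h1
  norm_num at h1

theorem isPositive_proj (S : Set ℕ) : (proj S).IsPositive := by
  rw [ContinuousLinearMap.isPositive_def']
  constructor
  · rw [ContinuousLinearMap.isSelfAdjoint_iff_isSymmetric]
    intro x y
    change inner ℂ (proj S x) y = inner ℂ x (proj S y)
    rw [lp.inner_eq_tsum, lp.inner_eq_tsum]
    refine tsum_congr fun k => ?_
    by_cases hk : k ∈ S <;> simp [proj_apply, hk]
  · intro x
    change 0 ≤ RCLike.re (inner ℂ (proj S x) x)
    have : inner ℂ (proj S x) x = inner ℂ (proj S x) (proj S x) := by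
      rw [lp.inner_eq_tsum, lp.inner_eq_tsum]
      refine tsum_congr fun k => ?_
      by_cases hk : k ∈ S <;> simp [proj_apply, hk]
    rw [this]
    exact inner_self_nonneg

theorem proj_le_proj {S T : Set ℕ} (h : S ⊆ T) : proj S ≤ proj T := by
  rw [ContinuousLinearMap.le_def, proj_sub_proj h]
  exact isPositive_proj _

theorem proj_injective : Function.Injective proj := fun _ _ h =>
  (subset_of_proj_le h.le).antisymm (subset_of_proj_le h.ge)

theorem proj_lt_proj {S T : Set ℕ} (h : S ⊂ T) : proj S < proj T :=
  lt_of_le_of_ne (proj_le_proj h.subset) fun h' => h.ne (proj_injective h')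

/-- Lower sets treat the finite members of the nest and the identity uniformly. -/
theorem mem_canonicalNest_iff_isLowerSet {N : Ell2 →L[ℂ] Ell2} (hN : N ∈ canonicalNest) :
    ∃ S : Set ℕ, IsLowerSet S ∧ N = proj S := by
  rcases mem_canonicalNest.1 hN with ⟨n, rfl⟩ | rfl
  · exact ⟨_, isLowerSet_Iio n, rfl⟩
  · exact ⟨_, isLowerSet_univ, proj_univ.symm⟩

theorem exists_ordConnected {E : Ell2 →L[ℂ] Ell2} (h : IsInterval canonicalNest E ∨ E = 0) :
    ∃ S : Set ℕ, S.OrdConnected ∧ E = proj S := by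
  rcases h with ⟨M, hM, N, hN, hlt, rfl⟩ | rfl
  · obtain ⟨S, hS, rfl⟩ := mem_canonicalNest_iff_isLowerSet hM
    obtain ⟨T, hT, rfl⟩ := mem_canonicalNest_iff_isLowerSet hN
    refine ⟨T \ S, ?_, proj_sub_proj (subset_of_proj_le hlt.le)⟩
    rw [Set.sdiff_eq]
    exact hT.ordConnected.inter hS.compl.ordConnected
  · exact ⟨∅, Set.ordConnected_empty, proj_empty.symm⟩

theorem isInterval_proj_Ico {a b : ℕ} (h : a < b) :
    IsInterval canonicalNest (proj (Set.Ico a b)) := by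
  have hss : Set.Iio a ⊂ Set.Iio b := Set.Iio_ssubset_Iio h
  refine ⟨_, mem_canonicalNest.2 (Or.inl ⟨a, rfl⟩), _, mem_canonicalNest.2 (Or.inl ⟨b, rfl⟩),
    proj_lt_proj hss, ?_⟩
  rw [proj_sub_proj hss.subset]
  congr 1
  ext k
  simp

theorem single_mem_range_proj {S : Set ℕ} {j : ℕ} (hj : j ∈ S) :
    (lp.single 2 j (1 : ℂ) : Ell2) ∈ (proj S).range :=
  mem_range_proj.2 fun _ hk => lp.single_apply_ne 2 _ _ fun h => hk (h ▸ hj)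

theorem linearIndependent_single :
    LinearIndependent ℂ fun j : ℕ => (lp.single 2 j (1 : ℂ) : Ell2) := by
  rw [linearIndependent_iff']
  intro s g hg i hi
  have := congrArg (fun x : Ell2 => x i) hg
  simp only [lp.coeFn_sum, Finset.sum_apply, lp.coeFn_smul, Pi.smul_apply] at this
  rw [Finset.sum_eq_single_of_mem i hi] at this
  · simpa using this
  · intro j _ hj
    rw [lp.single_apply_ne _ _ _ hj.symm, smul_zero]

theorem card_le_finrank_range_proj {S : Set ℕ} [FiniteDimensional ℂ (proj S).range]
    (s : Finset ℕ) (hs : ↑s ⊆ S) : s.card ≤ Module.finrank ℂ (proj S).range := by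
  have h := linearIndependent_single.comp (fun j : s => (j : ℕ)) Subtype.val_injective
  have h2 : LinearIndependent ℂ
      (fun j : s => (⟨lp.single 2 (j : ℕ) (1 : ℂ), single_mem_range_proj (hs j.2)⟩ :
        (proj S).range)) := by
    apply LinearIndependent.of_comp (proj S).range.subtype
    exact h
  simpa using h2.fintype_card_le_finrank

theorem finite_of_finiteDimensional_range {S : Set ℕ} (h : FiniteDimensional ℂ (proj S).range) :
    S.Finite := by
  by_contra hS
  obtain ⟨t, ht, hc⟩ := Set.Infinite.exists_subset_card_eq hS
    (Module.finrank ℂ (proj S).range + 1)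
  have := card_le_finrank_range_proj t ht
  omega

theorem finiteDimensional_range_proj {S : Set ℕ} (hS : S.Finite) :
    FiniteDimensional ℂ (proj S).range := by
  obtain ⟨n, hn⟩ := hS.bddAbove
  refine Submodule.finiteDimensional_of_le (S₂ := initialSpan (n + 1)) fun x hx => ?_
  refine mem_initialSpan.2 fun k hk => mem_range_proj.1 hx k fun hkS => ?_
  have := hn hkS
  omega

end Nest

/-! ### Non-diagonal and non-maximal primitive ideals -/

section Primitive

/-- Closedness makes the algebra complete, so that inverses given by Neumann series are again upper
triangular. -/
theorem isClosed_upperTriangular : IsClosed (upperTriangular : Set (Ell2 →L[ℂ] Ell2)) := by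
  refine isClosed_of_closure_subset fun X hX => ?_
  refine mem_upperTriangular_iff_entry.2 fun i j hij => norm_le_zero_iff.1 ?_
  refine le_of_forall_pos_le_add fun ε hε => ?_
  obtain ⟨Y, hY, hXY⟩ := Metric.mem_closure_iff.1 hX ε hε
  have h := norm_entry_le (X - Y) i j
  rw [entry_sub, mem_upperTriangular_iff_entry.1 hY i j hij, sub_zero] at h
  rw [dist_eq_norm] at hXY
  linarith

instance : CompleteSpace upperTriangular := isClosed_upperTriangular.completeSpace_coe

/-- Coordinate projections as elements of the algebra of upper triangular operators. -/
noncomputable def diagProj (S : Set ℕ) : upperTriangular := ⟨proj S, proj_mem S⟩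

@[simp]
theorem coe_diagProj (S : Set ℕ) : (diagProj S : Ell2 →L[ℂ] Ell2) = proj S := rfl

variable {P : TwoSidedIdeal upperTriangular}

theorem compress_singleton (n : ℕ) (X : Ell2 →L[ℂ] Ell2) :
    proj {n} * X * proj {n} = entry X n n • proj {n} := by
  refine ext_entry fun i j => ?_
  have : entry (entry X n n • proj {n}) i j = entry X n n * entry (proj {n}) i j := by simp [entry]
  rw [this, entry_compress, entry_proj]
  by_cases hi : i = n <;> by_cases hj : j = n
  · simp [hi, hj]
  · simp [hi, hj, Ne.symm hj]
  · simp [hi]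
  · simp [hi]

/-- Compressing to the `n`-th coordinate multiplies `diagProj {n}` by the diagonal entry, and taking
this entry is multiplicative on the algebra. Primeness, used twice with `diagProj {n}` as the factor
outside `P`, turns a vanishing entry into membership. -/
theorem mem_iff_entry_eq_zero (hP : IsPrimitiveIdeal P) {n : ℕ} (hn : diagProj {n} ∉ P)
    (X : upperTriangular) : X ∈ P ↔ entry X n n = 0 := by
  constructor
  · intro hX
    by_contra h0
    refine hn ?_
    have h1 : diagProj {n} * X * diagProj {n} = entry X n n • diagProj {n} :=
      Subtype.ext (compress_singleton n X)
    have h2 : (entry X n n)⁻¹ • (1 : upperTriangular) * (diagProj {n} * X * diagProj {n})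
        = diagProj {n} := by
      rw [h1, smul_mul_smul_comm, one_mul, inv_mul_cancel₀ h0, one_smul]
    rw [← h2]
    exact P.mul_mem_left _ _ (P.mul_mem_right _ _ (P.mul_mem_left _ _ hX))
  · have key : ∀ Y : upperTriangular, entry Y n n = 0 → Y * diagProj {n} ∈ P := by
      intro Y hY
      refine (hP.mem_or_mem (a := diagProj {n}) fun c => ?_).resolve_left hn
      have h1 : diagProj {n} * c * (Y * diagProj {n}) = 0 := by
        refine Subtype.ext ?_
        have := compress_singleton n (c * Y : upperTriangular)
        rw [Subalgebra.coe_mul, entry_mul_diag c.2 Y.2, hY, mul_zero, zero_smul] at this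
        simpa [mul_assoc] using this
      rw [h1]
      exact P.zero_mem
    intro hX
    refine (hP.mem_or_mem (b := diagProj {n}) fun c => key (X * c) ?_).resolve_right hn
    rw [Subalgebra.coe_mul, entry_mul_diag X.2 c.2, hX, zero_mul]

theorem diagSeminormPlus_eq_zero_iff (n : ℕ) (X : Ell2 →L[ℂ] Ell2) :
    diagSeminormPlus canonicalNest (proj (Set.Iio n)) X = 0 ↔ entry X n n = 0 := by
  have hss : Set.Iio n ⊂ Set.Iio (n + 1) := Set.Iio_ssubset_Iio (Nat.lt_succ_self n)
  have hmem : ‖(proj (Set.Iio (n + 1)) - proj (Set.Iio n)) * X *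
      (proj (Set.Iio (n + 1)) - proj (Set.Iio n))‖ ∈
      {r : ℝ | ∃ M ∈ canonicalNest, proj (Set.Iio n) < M ∧
        r = ‖(M - proj (Set.Iio n)) * X * (M - proj (Set.Iio n))‖} :=
    ⟨_, mem_canonicalNest.2 (Or.inl ⟨n + 1, rfl⟩), proj_lt_proj hss, rfl⟩
  constructor
  · intro h
    rw [← norm_le_zero_iff, ← h]
    refine le_csInf ⟨_, hmem⟩ ?_
    rintro r ⟨M, hM, hlt, rfl⟩
    obtain ⟨T, hT, rfl⟩ := mem_canonicalNest_iff_isLowerSet hM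
    have hsub := subset_of_proj_le hlt.le
    rw [proj_sub_proj hsub]
    have hn : n ∈ T \ Set.Iio n := by
      refine ⟨?_, by simp⟩
      by_contra hnT
      refine hlt.not_ge (proj_le_proj fun k hk => ?_)
      by_contra hkn
      exact hnT (hT (not_lt.1 hkn) hk)
    have := norm_entry_le (proj (T \ Set.Iio n) * X * proj (T \ Set.Iio n)) n n
    rwa [entry_compress, if_pos ⟨hn, hn⟩] at this
  · intro h
    refine le_antisymm (csInf_le ⟨0, ?_⟩ ?_) (Real.sInf_nonneg ?_)
    · rintro r ⟨M, _, _, rfl⟩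
      exact norm_nonneg _
    · convert hmem using 1
      have : Set.Iio (n + 1) \ Set.Iio n = {n} := by ext k; simp; omega
      rw [proj_sub_proj hss.subset, this, compress_singleton, h, zero_smul, norm_zero]
    · rintro r ⟨M, _, _, rfl⟩
      exact norm_nonneg _

theorem proj_Iio_lt_one (n : ℕ) : proj (Set.Iio n) < 1 := by
  rw [← proj_univ]
  exact proj_lt_proj ((Set.ssubset_univ_iff).2 fun h => by
    have : n ∈ Set.Iio n := h ▸ Set.mem_univ n
    simp at this)

theorem diagProj_singleton_mem (hP : IsPrimitiveIdeal P)
    (hdiag : ¬ IsDiagonalIdeal canonicalNest P) (n : ℕ) : diagProj {n} ∈ P := by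
  by_contra hn
  refine hdiag (Or.inl ⟨_, mem_canonicalNest.2 (Or.inl ⟨n, rfl⟩), proj_Iio_lt_one n, fun X => ?_⟩)
  rw [diagSeminormPlus_eq_zero_iff]
  exact mem_iff_entry_eq_zero hP hn X

theorem diagProj_mem_of_finite (hP : IsPrimitiveIdeal P)
    (hdiag : ¬ IsDiagonalIdeal canonicalNest P) {S : Set ℕ} (hS : S.Finite) :
    diagProj S ∈ P := by
  induction S, hS using Set.Finite.induction_on with
  | empty =>
    have : diagProj ∅ = 0 := Subtype.ext proj_empty
    rw [this]
    exact P.zero_mem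
  | @insert a s ha _ ih =>
    have : diagProj (insert a s) = diagProj {a} + diagProj s := by
      refine Subtype.ext (ext_coord fun x k => ?_)
      change proj _ x k = proj _ x k + proj _ x k
      by_cases hka : k = a
      · subst hka
        simp [proj_apply, ha]
      · by_cases hks : k ∈ s <;> simp [proj_apply, hka, hks]
    rw [this]
    exact P.add_mem (diagProj_singleton_mem hP hdiag a) ih

/-- A primitive ideal that is not a diagonal ideal contains an operator none of whose tails
is small. -/
theorem exists_mem_le_norm_tail (hP : IsPrimitiveIdeal P)
    (hdiag : ¬ IsDiagonalIdeal canonicalNest P) :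
    ∃ X ∈ P, ∃ ε > 0, ∀ n, ε ≤ ‖proj (Set.Ici n) * (X : Ell2 →L[ℂ] Ell2) * proj (Set.Ici n)‖ := by
  have htail : ∀ n, 1 - proj (Set.Iio n) = proj (Set.Ici n) := fun n => by
    rw [← proj_univ, proj_sub_proj (Set.subset_univ _)]
    congr 1
    ext k
    simp
  by_contra! hcon
  have hone : (1 : Ell2 →L[ℂ] Ell2) ∈ canonicalNest := mem_canonicalNest.2 (Or.inr rfl)
  have hmem : ∀ (X : Ell2 →L[ℂ] Ell2) n,
      ‖proj (Set.Ici n) * X * proj (Set.Ici n)‖ ∈ {r : ℝ | ∃ M ∈ canonicalNest, M < 1 ∧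
        r = ‖(1 - M) * X * (1 - M)‖} := fun X n =>
    ⟨_, mem_canonicalNest.2 (Or.inl ⟨n, rfl⟩), proj_Iio_lt_one n, by rw [htail]⟩
  refine hdiag (Or.inr ⟨1, hone, ?_, fun X => ⟨fun hX => ?_, fun hX => ?_⟩⟩)
  · have := proj_Iio_lt_one 0
    rwa [show Set.Iio 0 = (∅ : Set ℕ) by ext; simp, proj_empty] at this
  · refine le_antisymm (le_of_forall_pos_le_add fun ε hε => ?_) (Real.sInf_nonneg ?_)
    · obtain ⟨n, hn⟩ := hcon X hX ε hε
      rw [zero_add]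
      refine (csInf_le ⟨0, ?_⟩ (hmem X n)).trans hn.le
      rintro r ⟨M, _, _, rfl⟩
      exact norm_nonneg _
    · rintro r ⟨M, _, _, rfl⟩
      exact norm_nonneg _
  · refine hP.mem_of_forall_norm_lt fun ε hε => ?_
    obtain ⟨r, ⟨M, hM, hlt, rfl⟩, hr⟩ := exists_lt_of_csInf_lt ⟨_, hmem X 0⟩
      (show diagSeminormMinus canonicalNest 1 X < ε by rw [hX]; exact hε)
    rcases mem_canonicalNest.1 hM with ⟨n, rfl⟩ | rfl
    · refine ⟨diagProj (Set.Iio n) * X,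
        P.mul_mem_right _ _ (diagProj_mem_of_finite hP hdiag (Set.finite_Iio n)), ?_⟩
      refine lt_of_eq_of_lt ?_ hr
      change ‖(X : Ell2 →L[ℂ] Ell2) - proj (Set.Iio n) * (X : Ell2 →L[ℂ] Ell2)‖ = _
      congr 1
      -- By triangularity the tail compression equals `X` minus its first `n` rows, and those rows
      -- belong to `P`.
      have h1 : (1 - proj (Set.Iio n)) * (X : Ell2 →L[ℂ] Ell2) * proj (Set.Iio n) = 0 := by
        rw [htail]
        refine ext_entry fun i j => ?_
        rw [entry_compress]
        split_ifs with hij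
        · rw [mem_upperTriangular_iff_entry.1 X.2 i j (lt_of_lt_of_le hij.2 hij.1)]
          rfl
        · simp [entry]
      rw [mul_sub _ 1, h1, mul_one, sub_zero, sub_mul, one_mul]
    · exact absurd hlt (lt_irrefl _)

/-- If the limit ideal of a sequence of intervals of bounded length is contained in a primitive
ideal, then that ideal is maximal. -/
theorem isCoatom_of_bounded (hP : IsPrimitiveIdeal P) {F : Filter ℕ} {S : ℕ → Set ℕ}
    (hS : ∀ i, (S i).OrdConnected) {n : ℕ}
    (hb : ∀ᶠ i in F, ∀ k ∈ S i, ∀ l ∈ S i, l < k + n)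
    (hcont : ∀ X : upperTriangular,
      Tendsto (fun i => ‖proj (S i) * (X : Ell2 →L[ℂ] Ell2) * proj (S i)‖) F (𝓝 0) → X ∈ P) :
    IsCoatom P := by
  set s := {i | ∀ k ∈ S i, ∀ l ∈ S i, l < k + n} with hs
  -- `Q m`: inside each short interval the first `m` diagonals, counted from the main one, vanish.
  -- `Q 1` times `Q (m + 1)` lands in `Q (m + 2)`, so primeness descends from `Q (n + 1)`, where the
  -- compressions are zero, to `Q 1`.
  let Q : ℕ → upperTriangular → Prop := fun m Z =>
    ∀ i ∈ s, ∀ k ∈ S i, ∀ l ∈ S i, l < k + m → entry Z k l = 0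
  have hQn : ∀ Z, Q (n + 1) Z → Z ∈ P := by
    intro Z hZ
    refine hcont Z (tendsto_const_nhds.congr' ?_)
    filter_upwards [hb] with i hi
    have : proj (S i) * (Z : Ell2 →L[ℂ] Ell2) * proj (S i) = 0 := by
      refine ext_entry fun k l => ?_
      rw [entry_compress]
      split_ifs with h
      · rw [hZ i hi k h.1 l h.2 ((hi k h.1 l h.2).trans (by omega))]
        rfl
      · simp [entry]
    rw [this, norm_zero]
  have hQ : ∀ m, (∀ Z, Q (m + 1) Z → Z ∈ P) → ∀ Z, Q 1 Z → Z ∈ P := by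
    intro m
    induction m with
    | zero => exact fun h => h
    | succ m ih =>
      intro h
      refine (hP.subset_or_subset (J := Q 1) (K := Q (m + 1)) ?_ ?_).elim id ih
      · intro c b hb i hi k hk l hl hkl
        refine entry_mul_eq_zero b.2 fun j hj => ?_
        rcases lt_or_ge j k with hjk | hjk
        · exact Or.inl (mem_upperTriangular_iff_entry.1 c.2 k j hjk)
        · exact Or.inr (hb i hi j ((hS i).out hk hl ⟨hjk, hj⟩) l hl (by omega))
      · intro a b ha hb
        refine h _ fun i hi k hk l hl hkl => ?_
        refine entry_mul_eq_zero b.2 fun j hj => ?_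
        rcases lt_trichotomy j k with hjk | rfl | hjk
        · exact Or.inl (mem_upperTriangular_iff_entry.1 a.2 k j hjk)
        · exact Or.inl (ha i hi _ hk _ hk (by omega))
        · exact Or.inr (hb i hi j ((hS i).out hk hl ⟨hjk.le, hj⟩) l hl (by omega))
  -- Commutators of upper triangular operators have zero main diagonal, hence satisfy `Q 1`.
  refine hP.isCoatom_of_commutator_mem fun a b => hQ n hQn _ fun i _ k _ l _ hkl => ?_
  rcases eq_or_lt_of_le (Nat.lt_succ_iff.1 hkl) with rfl | hlk
  · change entry ((a : Ell2 →L[ℂ] Ell2) * b - b * a) _ _ = 0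
    rw [entry_sub, entry_mul_diag a.2 b.2, entry_mul_diag b.2 a.2, mul_comm, sub_self]
  · exact mem_upperTriangular_iff_entry.1 (a * b - b * a).2 k l hlk

/-- For a primitive ideal that is not maximal, the ranks of intervals whose limit ideal is
contained in it tend to infinity. -/
theorem tendsto_finrank (hP : IsPrimitiveIdeal P) (hmax : ¬ IsCoatom P) {𝒰 : Ultrafilter ℕ}
    {S : ℕ → Set ℕ} (hS : ∀ i, (S i).OrdConnected)
    (hfin : ∀ i, FiniteDimensional ℂ (proj (S i)).range)
    (hcont : ∀ X : upperTriangular,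
      Tendsto (fun i => ‖proj (S i) * (X : Ell2 →L[ℂ] Ell2) * proj (S i)‖) 𝒰 (𝓝 0) → X ∈ P) :
    Tendsto (fun i => Module.finrank ℂ (proj (S i)).range) 𝒰 atTop := by
  refine tendsto_atTop.2 fun n => ?_
  by_contra hn
  refine hmax (isCoatom_of_bounded hP hS (n := n) ?_ hcont)
  filter_upwards [Ultrafilter.eventually_not.2 hn] with i hi k hk l hl
  by_contra! hkl
  refine hi ?_
  have h := card_le_finrank_range_proj (S := S i) (Finset.Icc k l) (by
    rw [Finset.coe_Icc]
    exact (hS i).out hk hl)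
  rw [Nat.card_Icc] at h
  omega

end Primitive

/-! ### Splitting the intervals -/

section Splitting

variable {P : TwoSidedIdeal upperTriangular}

/-- In an entry of `X * Y` with both indices in `S`, only middle indices between them contribute,
and these lie in `S` again. Thus compression to an interval is multiplicative on the algebra. -/
theorem compress_mul {S : Set ℕ} (hS : S.OrdConnected) {X Y : Ell2 →L[ℂ] Ell2}
    (hX : X ∈ upperTriangular) (hY : Y ∈ upperTriangular) :
    proj S * (X * Y) * proj S = proj S * X * proj S * (Y * proj S) := by
  have hc : 1 - proj S = proj Sᶜ := by
    rw [← proj_univ, proj_sub_proj (Set.subset_univ S), Set.compl_eq_univ_sdiff]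
  have h0 : proj S * (X * (proj Sᶜ * Y)) * proj S = 0 := by
    refine ext_entry fun i j => ?_
    rw [entry_compress]
    split_ifs with hij
    · refine (entry_mul_eq_zero (mul_mem (proj_mem _) hY) fun k hkj => ?_).trans (by simp [entry])
      rcases lt_or_ge k i with hki | hki
      · exact Or.inl (mem_upperTriangular_iff_entry.1 hX i k hki)
      · right
        have hkS : k ∉ Sᶜ := fun h => h (hS.out hij.1 hij.2 ⟨hki, hkj⟩)
        rw [entry, mul_apply_eq_comp, proj_apply_of_notMem hkS]
    · simp [entry]
  rw [← hc] at h0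
  rw [← sub_eq_zero, ← h0]
  noncomm_ring

theorem compress_eq_zero_of_lt {S T : Set ℕ} (h : ∀ k ∈ S, ∀ l ∈ T, k < l)
    {X : Ell2 →L[ℂ] Ell2} (hX : X ∈ upperTriangular) : proj T * X * proj S = 0 := by
  refine ext_entry fun i j => ?_
  rw [entry_compress]
  split_ifs with hij
  · rw [mem_upperTriangular_iff_entry.1 hX i j (h j hij.2 i hij.1)]
    simp [entry]
  · simp [entry]

theorem norm_proj_mul_le (S : Set ℕ) (X : Ell2 →L[ℂ] Ell2) : ‖proj S * X‖ ≤ ‖X‖ := by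
  simpa [proj_univ] using norm_compress_le S Set.univ X

theorem norm_mul_proj_le (S : Set ℕ) (X : Ell2 →L[ℂ] Ell2) : ‖X * proj S‖ ≤ ‖X‖ := by
  simpa [proj_univ] using norm_compress_le Set.univ S X

/-- With respect to `S₀` below `S₁` the compressions are upper triangular 2 × 2 block matrices. The
first block column of `X` is just its `S₀` block, and the second block row of `Y` is just its `S₁`
block. -/
theorem norm_compress_mul_le {S S₀ S₁ : Set ℕ} (hS : S.OrdConnected)
    (hadd : proj S = proj S₀ + proj S₁) (hlt : ∀ k ∈ S₀, ∀ l ∈ S₁, k < l)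
    {X Y : Ell2 →L[ℂ] Ell2} (hX : X ∈ upperTriangular) (hY : Y ∈ upperTriangular) :
    ‖proj S * (X * Y) * proj S‖ ≤
      ‖proj S₀ * X * proj S₀‖ * ‖Y‖ + ‖X‖ * ‖proj S₁ * Y * proj S₁‖ := by
  have hX0 : proj S * X * proj S₀ = proj S₀ * X * proj S₀ := by
    rw [hadd, add_mul, add_mul, compress_eq_zero_of_lt hlt hX, add_zero]
  have hY0 : proj S₁ * Y * proj S = proj S₁ * Y * proj S₁ := by
    rw [hadd, mul_add, compress_eq_zero_of_lt hlt hY, zero_add]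
  have h : proj S * (X * Y) * proj S =
      proj S₀ * X * proj S₀ * (Y * proj S) + proj S * X * (proj S₁ * Y * proj S₁) := by
    rw [compress_mul hS hX hY, ← hX0, ← hY0]
    conv_lhs => rw [mul_assoc (proj S * X)]; enter [2, 1]; rw [hadd]
    noncomm_ring
  rw [h]
  refine (norm_add_le _ _).trans (add_le_add ?_ ?_)
  · exact (norm_mul_le _ _).trans (by gcongr; exact norm_mul_proj_le _ _)
  · exact (norm_mul_le _ _).trans (by gcongr; exact norm_proj_mul_le _ _)

/-- A primitive ideal containing the limit ideal of a sequence of intervals contains that of the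
upper or that of the lower parts of the intervals. -/
theorem limit_subset_or_subset (hP : IsPrimitiveIdeal P) {F : Filter ℕ} {S S₀ S₁ : ℕ → Set ℕ}
    (hS : ∀ i, (S i).OrdConnected) (hS₁ : ∀ i, (S₁ i).OrdConnected)
    (hadd : ∀ i, proj (S i) = proj (S₀ i) + proj (S₁ i))
    (hlt : ∀ᶠ i in F, ∀ k ∈ S₀ i, ∀ l ∈ S₁ i, k < l)
    (hcont : ∀ X : upperTriangular,
      Tendsto (fun i => ‖proj (S i) * (X : Ell2 →L[ℂ] Ell2) * proj (S i)‖) F (𝓝 0) → X ∈ P) :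
    (∀ X : upperTriangular,
      Tendsto (fun i => ‖proj (S₀ i) * (X : Ell2 →L[ℂ] Ell2) * proj (S₀ i)‖) F (𝓝 0) → X ∈ P) ∨
    (∀ X : upperTriangular,
      Tendsto (fun i => ‖proj (S₁ i) * (X : Ell2 →L[ℂ] Ell2) * proj (S₁ i)‖) F (𝓝 0) →
        X ∈ P) := by
  refine hP.subset_or_subset ?_ ?_
  · intro c b hb
    have h := hb.const_mul ‖(c : Ell2 →L[ℂ] Ell2)‖
    rw [mul_zero] at h
    refine squeeze_zero (fun _ => norm_nonneg _) (fun i => ?_) h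
    rw [Subalgebra.coe_mul, compress_mul (hS₁ i) c.2 b.2]
    have : proj (S₁ i) * (c : Ell2 →L[ℂ] Ell2) * proj (S₁ i) *
        ((b : Ell2 →L[ℂ] Ell2) * proj (S₁ i)) = (proj (S₁ i) * (c : Ell2 →L[ℂ] Ell2)) *
        (proj (S₁ i) * (b : Ell2 →L[ℂ] Ell2) * proj (S₁ i)) := by noncomm_ring
    rw [this]
    exact (norm_mul_le _ _).trans (by gcongr; exact norm_proj_mul_le _ _)
  · intro a b ha hb
    refine hcont _ ?_
    have h := (ha.mul_const ‖(b : Ell2 →L[ℂ] Ell2)‖).add (hb.const_mul ‖(a : Ell2 →L[ℂ] Ell2)‖)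
    rw [zero_mul, mul_zero, add_zero] at h
    refine squeeze_zero' (Eventually.of_forall fun _ => norm_nonneg _) ?_ h
    filter_upwards [hlt] with i hi
    exact norm_compress_mul_le (hS i) (hadd i) hi a.2 b.2

/-- Compare diagonal entries: each is 0 or 1, so two ones can never be added. -/
theorem disjoint_and_union_of_proj_eq_add {S S₀ S₁ : Set ℕ} (h : proj S = proj S₀ + proj S₁) :
    Disjoint S₀ S₁ ∧ S₀ ∪ S₁ = S := by
  have hk : ∀ k, entry (proj S) k k = entry (proj S₀) k k + entry (proj S₁) k k := fun k => by
    rw [h]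
    simp [entry]
  have hd : Disjoint S₀ S₁ := Set.disjoint_left.2 fun k h0 h1 => by
    have := hk k
    by_cases hS : k ∈ S <;> simp [entry_proj, h0, h1, hS] at this
    norm_num at this
  refine ⟨hd, Set.ext fun k => ?_⟩
  have := hk k
  revert this
  by_cases hS : k ∈ S <;> by_cases h0 : k ∈ S₀ <;> by_cases h1 : k ∈ S₁ <;>
    norm_num [entry_proj, hS, h0, h1]

theorem lt_or_lt_of_disjoint {S₀ S₁ : Set ℕ} (h0 : S₀.OrdConnected) (h1 : S₁.OrdConnected)
    (hd : Disjoint S₀ S₁) :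
    (∀ k ∈ S₀, ∀ l ∈ S₁, k < l) ∨ (∀ l ∈ S₁, ∀ k ∈ S₀, l < k) := by
  by_contra! hcon
  obtain ⟨⟨k, hk, l, hl, hlk⟩, l', hl', k', hk', hkl'⟩ := hcon
  rcases le_total k' l with h | h
  · exact Set.disjoint_left.1 hd (h0.out hk' hk ⟨h, hlk⟩) hl
  · exact Set.disjoint_left.1 hd hk' (h1.out hl hl' ⟨h, hkl'⟩)

/-- Finiteness and orthogonality pass to subintervals, and the growth of ranks is automatic by
`tendsto_finrank`; only the containment has to be supplied. -/
theorem ContainsLimitIdeal.of_subset (hP : IsPrimitiveIdeal P) (hmax : ¬ IsCoatom P)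
    {𝒰 : Ultrafilter ℕ} {S T : ℕ → Set ℕ}
    (h : ContainsLimitIdeal canonicalNest P 𝒰 fun i => proj (S i))
    (hTS : ∀ i, T i ⊆ S i) (hT : ∀ i, (T i).OrdConnected)
    (hint : ∀ i, IsInterval canonicalNest (proj (T i)) ∨ proj (T i) = 0)
    (hcont : ∀ X : upperTriangular,
      Tendsto (fun i => ‖proj (T i) * (X : Ell2 →L[ℂ] Ell2) * proj (T i)‖) 𝒰 (𝓝 0) → X ∈ P) :
    ContainsLimitIdeal canonicalNest P 𝒰 fun i => proj (T i) := by
  have hfin : ∀ i, FiniteDimensional ℂ (proj (T i)).range := fun i =>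
    finiteDimensional_range_proj
      ((finite_of_finiteDimensional_range (h.finite_rank i)).subset (hTS i))
  refine ⟨hint, hfin, fun i j hij => ?_, tendsto_finrank hP hmax hT hfin hcont, hcont⟩
  have h1 : proj (S i) * proj (S j) = 0 := h.orthogonal hij
  change proj (T i) * proj (T j) = 0
  rw [proj_mul_proj, ← proj_empty] at h1
  have h2 := proj_injective h1
  rw [proj_mul_proj, ← proj_empty]
  congr 1
  exact Set.subset_empty_iff.1 (h2 ▸ Set.inter_subset_inter (hTS i) (hTS j))

theorem ContainsLimitIdeal.of_add (hP : IsPrimitiveIdeal P) (hmax : ¬ IsCoatom P)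
    {𝒰 : Ultrafilter ℕ} {E E₀ E₁ : ℕ → Ell2 →L[ℂ] Ell2}
    (h : ContainsLimitIdeal canonicalNest P 𝒰 E)
    (h₀ : ∀ i, IsInterval canonicalNest (E₀ i) ∨ E₀ i = 0)
    (h₁ : ∀ i, IsInterval canonicalNest (E₁ i) ∨ E₁ i = 0)
    (hadd : ∀ i, E i = E₀ i + E₁ i) :
    ContainsLimitIdeal canonicalNest P 𝒰 E₀ ∨ ContainsLimitIdeal canonicalNest P 𝒰 E₁ := by
  choose S hS hES using fun i => exists_ordConnected (h.interval_or_zero i)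
  choose S₀ hS₀ hES₀ using fun i => exists_ordConnected (h₀ i)
  choose S₁ hS₁ hES₁ using fun i => exists_ordConnected (h₁ i)
  obtain rfl : E = fun i => proj (S i) := funext hES
  obtain rfl : E₀ = fun i => proj (S₀ i) := funext hES₀
  obtain rfl : E₁ = fun i => proj (S₁ i) := funext hES₁
  have hd := fun i => disjoint_and_union_of_proj_eq_add (hadd i)
  have hadd' : ∀ i, proj (S i) = proj (S₁ i) + proj (S₀ i) := fun i => by
    rw [add_comm]; exact hadd i
  have h0 := ContainsLimitIdeal.of_subset hP hmax h
    (fun i => (hd i).2 ▸ Set.subset_union_left) hS₀ h₀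
  have h1 := ContainsLimitIdeal.of_subset hP hmax h
    (fun i => (hd i).2 ▸ Set.subset_union_right) hS₁ h₁
  have hor : ∀ᶠ i in (𝒰 : Filter ℕ), (∀ k ∈ S₀ i, ∀ l ∈ S₁ i, k < l) ∨
      (∀ l ∈ S₁ i, ∀ k ∈ S₀ i, l < k) :=
    Eventually.of_forall fun i => lt_or_lt_of_disjoint (hS₀ i) (hS₁ i) (hd i).1
  -- Which part is the lower one may vary with `i`; the ultrafilter selects one order.
  rcases Ultrafilter.eventually_or.1 hor with hlt | hlt
  · exact (limit_subset_or_subset hP hS hS₁ hadd hlt h.contains).imp h0 h1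
  · exact (limit_subset_or_subset hP hS hS₀ hadd' hlt h.contains).symm.imp h0 h1

end Splitting

/-! ### Operators supported far above the diagonal -/

section Gap

theorem inner_proj_left (S : Set ℕ) (x y : Ell2) : inner ℂ (proj S x) y = inner ℂ x (proj S y) :=
  (ContinuousLinearMap.isSelfAdjoint_iff_isSymmetric.1 (isPositive_proj S).isSelfAdjoint) x y

theorem inner_eq_zero_of_disjoint {x y : Ell2} (h : ∀ k, x k = 0 ∨ y k = 0) :
    inner ℂ x y = 0 := by
  rw [lp.inner_eq_tsum]
  refine (tsum_congr fun k => ?_).trans tsum_zero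
  rcases h k with h | h <;> simp [h]

theorem tendsto_proj_Iio (x : Ell2) : Tendsto (fun n => proj (Set.Iio n) x) atTop (𝓝 x) := by
  refine (lp.hasSum_single (p := 2) (by simp) x).tendsto_sum_nat.congr fun n => ?_
  have h := eq_sum_single (n := n) (x := proj (Set.Iio n) x) fun k hk =>
    proj_apply_of_notMem (by simpa using hk) x
  rw [h]
  refine Finset.sum_congr rfl fun j hj => ?_
  rw [proj_apply_of_mem (by simpa using hj), ← lp.single_smul]
  simp

theorem exists_vectors_of_le_norm_tail {X : Ell2 →L[ℂ] Ell2} {ε : ℝ} (hε : 0 < ε)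
    (hX : ∀ n, ε ≤ ‖proj (Set.Ici n) * X * proj (Set.Ici n)‖) (a : ℕ) {δ : ℝ} (hδ : 0 < δ) :
    ∃ (b : ℕ) (η ξ : Ell2), a < b ∧ (∀ k, k ∉ Set.Ico a b → η k = 0) ∧
      (∀ k, k ∉ Set.Ico a b → ξ k = 0) ∧ ‖η‖ ≤ 1 ∧ ‖ξ‖ ≤ 2 / ε ∧ inner ℂ η (X ξ) = 1 ∧
      ∀ z : Ell2, (∀ k, k < b → z k = 0) → ‖inner ℂ η (X z)‖ ≤ δ * ‖z‖ := by
  -- Halving `ε` leaves room for truncating both vectors to finite support; it is also the source of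
  -- the bound `2 / ε`, when the second vector is rescaled to make the pairing 1.
  obtain ⟨x, hx1, hx⟩ := ContinuousLinearMap.exists_lt_apply_of_lt_opNorm
    (proj (Set.Ici a) * X * proj (Set.Ici a)) (r := ε / 2) (by have := hX a; linarith)
  set y := proj (Set.Ici a) x with hy
  have hy1 : ‖y‖ ≤ 1 := (norm_proj_apply_le _ _).trans hx1.le
  set z := proj (Set.Ici a) (X y) with hz
  change ε / 2 < ‖z‖ at hx
  have hz0 : (‖z‖ : ℂ) ≠ 0 := by
    have : ‖z‖ ≠ 0 := by linarith
    exact_mod_cast this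
  set u : Ell2 := (‖z‖ : ℂ)⁻¹ • z with hu
  have hu1 : ‖u‖ = 1 := by
    rw [hu, norm_smul, norm_inv, Complex.norm_real, norm_norm, inv_mul_cancel₀]
    exact_mod_cast hz0
  have hzk : ∀ k < a, z k = 0 := fun k hk => proj_apply_of_notMem (by simpa using hk) _
  have hyk : ∀ k < a, y k = 0 := fun k hk => proj_apply_of_notMem (by simpa using hk) _
  have huk : ∀ k < a, u k = 0 := fun k hk => by
    rw [hu, lp.coeFn_smul, Pi.smul_apply, hzk k hk, smul_zero]
  have hin : ‖inner ℂ u (X y)‖ = ‖z‖ := by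
    have h1 : u = proj (Set.Ici a) u :=
      (proj_eq_self fun k hk => huk k (by simpa using hk)).symm
    rw [h1, inner_proj_left, ← hz, hu, inner_smul_left, norm_mul, inner_self_eq_norm_sq_to_K]
    simp only [map_inv₀, Complex.conj_ofReal, norm_inv, Complex.norm_real, norm_norm, norm_pow,
      Complex.coe_algebraMap]
    have : ‖z‖ ≠ 0 := by exact_mod_cast hz0
    field_simp
  obtain ⟨n, hn⟩ := (((tendsto_proj_Iio u).inner (tendsto_const_nhds (x := X y))).norm.eventually
    (lt_mem_nhds (hin.symm ▸ hx))).exists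
  set η := proj (Set.Iio n) u with hη
  have ht1 : ∀ᶠ b in atTop, ε / 2 < ‖inner ℂ η (X (proj (Set.Iio b) y))‖ :=
    ((tendsto_const_nhds (x := η)).inner
      ((X.continuous.tendsto y).comp (tendsto_proj_Iio y))).norm.eventually (lt_mem_nhds hn)
  -- `X.adjoint η` is a fixed vector of `ℓ²`, so its tail beyond `b` is small; this bounds the
  -- pairing with every `z` supported beyond `b`.
  have ht2 : ∀ᶠ b in atTop, ‖X.adjoint η - proj (Set.Iio b) (X.adjoint η)‖ < δ := by
    have h := ((tendsto_const_nhds (x := X.adjoint η)).sub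
      (tendsto_proj_Iio (X.adjoint η))).norm
    rw [sub_self, norm_zero] at h
    exact h.eventually (gt_mem_nhds hδ)
  obtain ⟨b, hb1, hb2, hbn, hba⟩ := (ht1.and (ht2.and
    ((eventually_ge_atTop n).and (eventually_gt_atTop a)))).exists
  set t := inner ℂ η (X (proj (Set.Iio b) y)) with ht
  have ht0 : t ≠ 0 := by
    intro h0
    rw [h0, norm_zero] at hb1
    linarith
  refine ⟨b, η, t⁻¹ • proj (Set.Iio b) y, hba, fun k hk => ?_, fun k hk => ?_,
    (norm_proj_apply_le _ _).trans hu1.le, ?_, ?_, fun w hw => ?_⟩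
  · by_cases hka : k < a
    · by_cases hkn : k ∈ Set.Iio n
      · rw [hη, proj_apply_of_mem hkn, huk k hka]
      · rw [hη, proj_apply_of_notMem hkn]
    · rw [hη, proj_apply_of_notMem]
      simp only [Set.mem_Ico, Set.mem_Iio, not_and, not_lt] at hk ⊢
      exact hbn.trans (hk (not_lt.1 hka))
  · rw [lp.coeFn_smul, Pi.smul_apply]
    by_cases hka : k < a
    · by_cases hkb : k ∈ Set.Iio b
      · rw [proj_apply_of_mem hkb, hyk k hka, smul_zero]
      · rw [proj_apply_of_notMem hkb, smul_zero]
    · rw [proj_apply_of_notMem, smul_zero]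
      simp only [Set.mem_Ico, Set.mem_Iio, not_and, not_lt] at hk ⊢
      exact hk (not_lt.1 hka)
  · rw [norm_smul, norm_inv]
    have h1 : ‖t‖⁻¹ ≤ (ε / 2)⁻¹ := inv_anti₀ (by positivity) hb1.le
    have h2 : ‖proj (Set.Iio b) y‖ ≤ 1 := (norm_proj_apply_le _ _).trans hy1
    calc _ ≤ (ε / 2)⁻¹ * 1 := by gcongr
      _ = 2 / ε := by rw [mul_one, inv_div]
  · rw [map_smul, inner_smul_right, ← ht, inv_mul_cancel₀ ht0]
  · rw [← ContinuousLinearMap.adjoint_inner_left]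
    have h0 : inner ℂ (proj (Set.Iio b) (X.adjoint η)) w = 0 :=
      inner_eq_zero_of_disjoint fun k => by
        by_cases hk : k < b
        · exact Or.inr (hw k hk)
        · exact Or.inl (proj_apply_of_notMem (by simpa using hk) _)
    have h1 : inner ℂ (X.adjoint η) w
        = inner ℂ (X.adjoint η - proj (Set.Iio b) (X.adjoint η)) w := by
      rw [inner_sub_left, h0, sub_zero]
    rw [h1]
    exact (norm_inner_le_norm _ _).trans (by gcongr)

/-- Vectors supported in disjoint blocks, as the rows of an operator. -/
theorem exists_rowOp {γ : ℕ → ℕ} {η : ℕ → Ell2} {C : ℝ} (hη : ∀ i k, η i k ≠ 0 → γ k = i)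
    (hC : ∀ i, ‖η i‖ ≤ C) :
    ∃ U : Ell2 →L[ℂ] Ell2, ∀ x i, U x i = inner ℂ (η i) x := by
  obtain ⟨U, -, hU⟩ := exists_blockOp γ id ((norm_nonneg _).trans (hC 0))
    (fun i => (innerSL ℂ (η i)).smulRight (lp.single 2 i (1 : ℂ) : Ell2)) fun i => by
      rw [ContinuousLinearMap.norm_smulRight_apply, innerSL_apply_norm, lp.norm_single (by simp)]
      simpa using hC i
  refine ⟨U, fun x i => ?_⟩
  rw [hU]
  simp only [id, ContinuousLinearMap.smulRight_apply, lp.coeFn_smul, Pi.smul_apply,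
    lp.single_apply_self, innerSL_apply_apply, smul_eq_mul, mul_one]
  rw [← inner_proj_left, proj_eq_self]
  intro k hk
  by_contra h
  exact hk (hη i k h)

/-- Vectors supported in disjoint blocks, as the columns of an operator. -/
theorem exists_columnOp (γ : ℕ → ℕ) {ξ : ℕ → Ell2} {C : ℝ} (hC : ∀ i, ‖ξ i‖ ≤ C) :
    ∃ W : Ell2 →L[ℂ] Ell2, ‖W‖ ≤ C ∧ ∀ x k, W x k = x (γ k) * ξ (γ k) k := by
  obtain ⟨W, hWC, hW⟩ := exists_blockOp id γ ((norm_nonneg _).trans (hC 0))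
    (fun i => (innerSL ℂ (lp.single 2 i (1 : ℂ) : Ell2)).smulRight (ξ i)) fun i => by
      rw [ContinuousLinearMap.norm_smulRight_apply, innerSL_apply_norm, lp.norm_single (by simp)]
      simpa using hC i
  refine ⟨W, hWC, fun x k => ?_⟩
  rw [hW]
  simp only [ContinuousLinearMap.smulRight_apply, lp.coeFn_smul, Pi.smul_apply,
    innerSL_apply_apply, smul_eq_mul]
  rw [lp.inner_single_left, proj_apply_of_mem (by simp)]
  simp

theorem exists_blockIndex {c : ℕ → ℕ} (hc : StrictMono c) :
    ∃ γ : ℕ → ℕ, ∀ i k, k ∈ Set.Ico (c i) (c (i + 1)) → γ k = i := by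
  have : ∀ k, ∃ g, ∀ i, k ∈ Set.Ico (c i) (c (i + 1)) → g = i := by
    intro k
    by_cases h : ∃ g, k ∈ Set.Ico (c g) (c (g + 1))
    · obtain ⟨g, hg⟩ := h
      refine ⟨g, fun i hi => ?_⟩
      have h1 := hc.lt_iff_lt.1 (hg.1.trans_lt hi.2)
      have h2 := hc.lt_iff_lt.1 (hi.1.trans_lt hg.2)
      omega
    · exact ⟨0, fun i hi => absurd ⟨i, hi⟩ h⟩
  choose γ hγ using this
  exact ⟨γ, fun i k => hγ k i⟩

theorem exists_mul_eq_one_of_norm_sub_lt {A : Type*} [NormedRing A] [CompleteSpace A] {a : A}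
    (h : ‖a - 1‖ < 1) : ∃ b, a * b = 1 := by
  rw [norm_sub_rev] at h
  refine ⟨↑(Units.oneSub _ h)⁻¹, ?_⟩
  have := Units.mul_inv (Units.oneSub _ h)
  rwa [Units.val_oneSub, sub_sub_cancel] at this

theorem sum_quarter_pow_le (s : Finset ℕ) : ∑ i ∈ s, ((1 / 2 : ℝ) ^ (i + 1)) ^ 2 ≤ (3 / 4) ^ 2 := by
  have he : (fun i : ℕ => ((1 / 2 : ℝ) ^ (i + 1)) ^ 2) = fun i => 1 / 4 * (1 / 4) ^ i := by
    funext i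
    rw [← pow_mul, mul_comm (i + 1), pow_mul, pow_succ]
    norm_num
    ring
  have h : HasSum (fun i : ℕ => ((1 / 2 : ℝ) ^ (i + 1)) ^ 2) (1 / 4 * (1 - 1 / 4)⁻¹) := by
    rw [he]
    exact (hasSum_geometric_of_lt_one (by norm_num) (by norm_num)).mul_left _
  exact (sum_le_hasSum s (fun i _ => by positivity) h).trans (by norm_num)

variable {P : TwoSidedIdeal upperTriangular}

/-- A primitive, non-diagonal ideal contains all operators whose matrix has its support
sufficiently far from the diagonal. -/
theorem exists_gap (hP : IsPrimitiveIdeal P) (hdiag : ¬ IsDiagonalIdeal canonicalNest P) :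
    ∃ c : ℕ → ℕ, StrictMono c ∧ 1 ≤ c 0 ∧ ∀ Y : upperTriangular,
      (∀ i j, j < c (i + 1) → entry Y i j = 0) → Y ∈ P := by
  obtain ⟨X, hXP, ε, hε, hX⟩ := exists_mem_le_norm_tail hP hdiag
  -- The factor `ε / 2` cancels the norm bound `2 / ε` of `W`, leaving row errors `(1 / 2) ^ (i +
  -- 1)` that are square summable with sum less than 1.
  choose b η' ξ' hb hη' hξ' hη1 hξ1 hpair htail using fun a i : ℕ =>
    exists_vectors_of_le_norm_tail hε hX a (δ := ε / 2 * (1 / 2) ^ (i + 1)) (by positivity)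
  -- Starting at 1 rather than 0 gives `i < c i`, so that iterating `c` later produces nonempty
  -- blocks.
  let c : ℕ → ℕ := fun n => Nat.rec (motive := fun _ => ℕ) 1 (fun i a => b a i) n
  have hc : StrictMono c := strictMono_nat_of_lt_succ fun i => hb (c i) i
  set η : ℕ → Ell2 := fun i => η' (c i) i
  set ξ : ℕ → Ell2 := fun i => ξ' (c i) i
  have hη : ∀ i k, k ∉ Set.Ico (c i) (c (i + 1)) → η i k = 0 := fun i => hη' (c i) i
  have hξ : ∀ i k, k ∉ Set.Ico (c i) (c (i + 1)) → ξ i k = 0 := fun i => hξ' (c i) i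
  have htl : ∀ i (z : Ell2), (∀ k, k < c (i + 1) → z k = 0) →
      ‖inner ℂ (η i) ((X : Ell2 →L[ℂ] Ell2) z)‖ ≤ ε / 2 * (1 / 2) ^ (i + 1) * ‖z‖ :=
    fun i => htail (c i) i
  obtain ⟨γ, hγ⟩ := exists_blockIndex hc
  obtain ⟨U, hU⟩ := exists_rowOp (γ := γ) (η := η) (C := 1)
    (fun i k h => hγ i k (by_contra fun hk => h (hη i k hk))) (fun i => hη1 _ _)
  obtain ⟨W, hWn, hW⟩ := exists_columnOp γ (ξ := ξ) (C := 2 / ε) (fun i => hξ1 _ _)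
  have hUA : U ∈ upperTriangular := by
    refine mem_upperTriangular_iff_entry.2 fun i j hij => ?_
    rw [entry, hU]
    refine inner_eq_zero_of_disjoint fun k => ?_
    by_cases hk : k = j
    · left
      refine hη i k fun h => ?_
      have := hc.id_le i
      have := h.1
      simp only [id] at *
      omega
    · exact Or.inr (lp.single_apply_ne 2 _ _ hk)
  have hlow : ∀ i (w : Ell2), (∀ k, c i ≤ k → w k = 0) →
      inner ℂ (η i) ((X : Ell2 →L[ℂ] Ell2) w) = 0 := fun i w hw =>
    inner_eq_zero_of_disjoint fun k => by
      by_cases hk : c i ≤ k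
      · exact Or.inr (mem_upperTriangular.1 X.2 (c i) w hw k hk)
      · exact Or.inl (hη i k fun h => hk h.1)
  set B : Ell2 →L[ℂ] Ell2 := U * X * W
  have hBx : ∀ x i, B x i = inner ℂ (η i) ((X : Ell2 →L[ℂ] Ell2) (W x)) := fun x i => hU _ i
  have hBA : B ∈ upperTriangular := by
    refine mem_upperTriangular_iff_entry.2 fun i j hij => ?_
    rw [entry, hBx]
    refine hlow i _ fun k hk => ?_
    rw [hW]
    by_cases hj : γ k = j
    · rw [hj, hξ j k, mul_zero]
      intro h
      exact absurd (h.2.trans_le (hc.monotone hij)) (not_lt.2 hk)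
    · rw [lp.single_apply_ne 2 _ _ hj, zero_mul]
  have hBcoord : ∀ x i, ‖(B x - x) i‖ ≤ (1 / 2) ^ (i + 1) * ‖x‖ := by
    intro x i
    -- The part below block `i` pairs to zero by triangularity of `X`, block `i` itself reproduces
    -- `x i`, and the part beyond is the error controlled by `htl`.
    have hsplit : W x = proj (Set.Iio (c i)) (W x) + x i • ξ i
        + proj (Set.Ici (c (i + 1))) (W x) := by
      refine lp.ext (funext fun k => ?_)
      simp only [lp.coeFn_add, Pi.add_apply, lp.coeFn_smul, Pi.smul_apply, smul_eq_mul]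
      have hci : c i < c (i + 1) := hc (Nat.lt_succ_self i)
      rcases lt_or_ge k (c i) with h1 | h1
      · rw [proj_apply_of_mem (show k ∈ Set.Iio (c i) from h1), proj_apply_of_notMem (by simp; omega), hξ i k (by simp; omega)]
        simp
      · rcases lt_or_ge k (c (i + 1)) with h2 | h2
        · rw [proj_apply_of_notMem (by simpa using h1), proj_apply_of_notMem (by simpa using h2),
            hW, hγ i k ⟨h1, h2⟩]
          simp
        · rw [proj_apply_of_mem (show k ∈ Set.Ici (c (i + 1)) from h2), proj_apply_of_notMem (by simpa using h1),
            hξ i k (by simp; omega)]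
          simp
    have h1 : (B x - x) i = inner ℂ (η i)
        ((X : Ell2 →L[ℂ] Ell2) (proj (Set.Ici (c (i + 1))) (W x))) := by
      rw [lp.coeFn_sub, Pi.sub_apply, hBx, hsplit, map_add, map_add, inner_add_right,
        inner_add_right, hlow i _ fun k hk => proj_apply_of_notMem (by simpa using hk) _,
        map_smul, inner_smul_right, show inner ℂ (η i) ((X : Ell2 →L[ℂ] Ell2) (ξ i)) = 1 from
          hpair _ _, ← hsplit]
      ring
    rw [h1]
    refine (htl i _ fun k hk => proj_apply_of_notMem (by simpa using hk) _).trans ?_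
    have h2 : ‖proj (Set.Ici (c (i + 1))) (W x)‖ ≤ 2 / ε * ‖x‖ :=
      (norm_proj_apply_le _ _).trans (W.le_of_opNorm_le hWn x)
    calc _ ≤ ε / 2 * (1 / 2) ^ (i + 1) * (2 / ε * ‖x‖) := by gcongr
      _ = _ := by field_simp
  have hBnorm : ‖B - 1‖ ≤ 3 / 4 := by
    refine ContinuousLinearMap.opNorm_le_bound _ (by norm_num) fun x => ?_
    refine norm_le_of_sum_sq_le (by positivity) fun s => ?_
    calc _ ≤ ∑ i ∈ s, ((1 / 2 : ℝ) ^ (i + 1)) ^ 2 * ‖x‖ ^ 2 := by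
          refine Finset.sum_le_sum fun i _ => ?_
          rw [← mul_pow]
          gcongr
          exact hBcoord x i
      _ ≤ _ := by
          rw [← Finset.sum_mul, mul_pow]
          gcongr
          exact sum_quarter_pow_le s
  set B' : upperTriangular := ⟨B, hBA⟩
  -- The inverse is taken inside the algebra, so `V` is upper triangular and `V * Y` keeps the gap
  -- of `Y`.
  obtain ⟨V, hV⟩ := exists_mul_eq_one_of_norm_sub_lt (a := B') (lt_of_le_of_lt hBnorm (by norm_num))
  refine ⟨c, hc, le_rfl, fun Y hY => ?_⟩
  set Z : upperTriangular := V * Y with hZdef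
  have hYZ : Y = B' * Z := by rw [hZdef, ← mul_assoc, hV, one_mul]
  have hZ : ∀ i j, j < c (i + 1) → entry Z i j = 0 := fun i j hij => by
    refine entry_mul_eq_zero Y.2 fun k _ => ?_
    rcases lt_or_ge k i with hki | hki
    · exact Or.inl (mem_upperTriangular_iff_entry.1 (Subtype.prop _) i k hki)
    · exact Or.inr (hY k j (hij.trans_le (hc.monotone (show i + 1 ≤ k + 1 by omega))))
  -- `W` pushes row `i` of `Z` down into rows of block `i`, all below `c (i + 1)`; the gap of `Z` is
  -- exactly what keeps the result on or above the diagonal.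
  have hWZ : W * (Z : Ell2 →L[ℂ] Ell2) ∈ upperTriangular := by
    refine mem_upperTriangular_iff_entry.2 fun k l hlk => ?_
    change W ((Z : Ell2 →L[ℂ] Ell2) (lp.single 2 l (1 : ℂ))) k = 0
    rw [hW]
    by_cases hk : k ∈ Set.Ico (c (γ k)) (c (γ k + 1))
    · exact mul_eq_zero_of_left (hZ (γ k) l (hlk.trans hk.2)) _
    · rw [hξ _ k hk, mul_zero]
  have hprod : B' * Z = (⟨U, hUA⟩ : upperTriangular) * X * ⟨_, hWZ⟩ :=
    Subtype.ext (by simp [B', B, mul_assoc])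
  rw [hYZ, hprod]
  exact P.mul_mem_right _ _ (P.mul_mem_left _ _ hXP)

end Gap

/-! ### Block decomposition and the ultrafilter -/

section Blocks

variable {P : TwoSidedIdeal upperTriangular}

theorem exists_mem_Ico {a : ℕ → ℕ} (ha : StrictMono a) (ha0 : a 0 = 0) (k : ℕ) :
    ∃ m, k ∈ Set.Ico (a m) (a (m + 1)) := by
  have h : ∃ m, k < a (m + 1) := ⟨k, (ha.id_le (k + 1) : k + 1 ≤ a (k + 1))⟩
  classical
  refine ⟨Nat.find h, ?_, Nat.find_spec h⟩
  rcases hm : Nat.find h with _ | m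
  · simp [ha0]
  · exact not_lt.1 (Nat.find_min h (m := m) (by omega))

/-- A primitive, non-diagonal ideal contains all strictly block upper triangular operators for
some decomposition of `ℕ` into finite consecutive blocks. -/
theorem exists_blocks (hP : IsPrimitiveIdeal P) (hdiag : ¬ IsDiagonalIdeal canonicalNest P) :
    ∃ a : ℕ → ℕ, StrictMono a ∧ a 0 = 0 ∧ ∀ Y : upperTriangular,
      (∀ m, ∀ i ∈ Set.Ico (a m) (a (m + 1)), ∀ j ∈ Set.Ico (a m) (a (m + 1)),
        entry Y i j = 0) → Y ∈ P := by
  obtain ⟨c, hc, hc0, hcP⟩ := exists_gap hP hdiag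
  have hlt : ∀ i, i < c i := fun i => by
    induction i with
    | zero => omega
    | succ i ih =>
      have := hc (Nat.lt_succ_self i)
      simp only [Nat.succ_eq_add_one] at this
      omega
  -- With `a (m + 1) = c (a m)`, an index `i` in block `m` has `c (i + 1) ≤ a (m + 2)`. Left of this
  -- gap, each middle index shares block `m` with `i` or block `m + 1` with `j`.
  let a : ℕ → ℕ := fun n => Nat.rec (motive := fun _ => ℕ) 0 (fun _ k => c k) n
  have has : ∀ m, a (m + 1) = c (a m) := fun m => rfl
  have ha : StrictMono a := strictMono_nat_of_lt_succ fun m => hlt (a m)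
  refine ⟨a, ha, rfl, ?_⟩
  refine (hP.subset_or_subset (K := fun Y : upperTriangular => ∀ m,
    ∀ i ∈ Set.Ico (a m) (a (m + 1)), ∀ j ∈ Set.Ico (a m) (a (m + 1)), entry Y i j = 0)
    ?_ ?_).elim id id
  · intro x y hy m i hi j hj
    refine entry_mul_eq_zero y.2 fun k hk => ?_
    rcases lt_or_ge k i with hki | hki
    · exact Or.inl (mem_upperTriangular_iff_entry.1 x.2 i k hki)
    · exact Or.inr (hy m k ⟨hi.1.trans hki, hk.trans_lt hj.2⟩ j hj)
  · intro x y hx hy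
    refine hcP _ fun i j hij => ?_
    obtain ⟨m, hm⟩ := exists_mem_Ico ha rfl i
    refine entry_mul_eq_zero y.2 fun k hk => ?_
    rcases lt_or_ge k i with hki | hki
    · exact Or.inl (mem_upperTriangular_iff_entry.1 x.2 i k hki)
    rcases lt_or_ge k (a (m + 1)) with hkm | hkm
    · exact Or.inl (hx m i hm k ⟨hm.1.trans hki, hkm⟩)
    · have h1 : j < a (m + 1 + 1) := hij.trans_le (hc.monotone hm.2)
      exact Or.inr (hy (m + 1) k ⟨hkm, hk.trans_lt h1⟩ j ⟨hkm.trans hk, h1⟩)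

/-- The operators whose diagonal blocks with index in `s` vanish. -/
def VanishOn (a : ℕ → ℕ) (s : Set ℕ) (Y : upperTriangular) : Prop :=
  ∀ m ∈ s, ∀ i ∈ Set.Ico (a m) (a (m + 1)), ∀ j ∈ Set.Ico (a m) (a (m + 1)), entry Y i j = 0

theorem VanishOn.mul {a : ℕ → ℕ} {s t : Set ℕ} {x y : upperTriangular} (hx : VanishOn a s x)
    (hy : VanishOn a t y) : VanishOn a (s ∪ t) (x * y) := by
  intro m hm i hi j hj
  refine entry_mul_eq_zero y.2 fun k hk => ?_
  rcases lt_or_ge k i with hki | hki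
  · exact Or.inl (mem_upperTriangular_iff_entry.1 x.2 i k hki)
  have hkm : k ∈ Set.Ico (a m) (a (m + 1)) := ⟨hi.1.trans hki, hk.trans_lt hj.2⟩
  exact hm.imp (fun h => hx m h i hi k hkm) fun h => hy m h k hkm j hj

theorem vanishOn_empty (a : ℕ → ℕ) (y : upperTriangular) : VanishOn a ∅ y :=
  fun _ hm => hm.elim

theorem VanishOn.mono {a : ℕ → ℕ} {s t : Set ℕ} (hst : s ⊆ t) {y : upperTriangular}
    (hy : VanishOn a t y) : VanishOn a s y := fun m hm => hy m (hst hm)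

open Classical in
theorem entry_proj_mul (S : Set ℕ) (X : Ell2 →L[ℂ] Ell2) (i j : ℕ) :
    entry (proj S * X) i j = if i ∈ S then entry X i j else 0 := by
  rw [entry, mul_apply_eq_comp, proj_apply]
  rfl

/-- Given a primitive ideal containing the strictly block upper triangular operators, the sets of
blocks on which vanishing implies membership in the ideal form an ultrafilter. -/
theorem exists_ultrafilter (hP : IsPrimitiveIdeal P) {a : ℕ → ℕ} (ha : StrictMono a)
    (haP : ∀ Y, VanishOn a Set.univ Y → Y ∈ P) :
    ∃ 𝒰 : Ultrafilter ℕ, ∀ s, s ∈ 𝒰 ↔ ∀ Y, VanishOn a s Y → Y ∈ P := by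
  obtain ⟨β, hβ⟩ := exists_blockIndex ha
  let F : Filter ℕ :=
    { sets := {s | ∀ Y, VanishOn a s Y → Y ∈ P}
      univ_sets := haP
      sets_of_superset := fun hs hst Y hY => hs Y (hY.mono hst)
      inter_sets := by
        intro s t hs ht Y hY
        -- Keeping the rows of the blocks in `s` gives an operator vanishing on `t`; the remaining
        -- rows give one vanishing on `s`.
        have hsplit : Y = diagProj (β ⁻¹' s) * Y + diagProj (β ⁻¹' sᶜ) * Y := by
          refine Subtype.ext (ext_coord fun x k => ?_)
          change (Y : Ell2 →L[ℂ] Ell2) x k = proj (β ⁻¹' s) ((Y : Ell2 →L[ℂ] Ell2) x) k +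
            proj (β ⁻¹' sᶜ) ((Y : Ell2 →L[ℂ] Ell2) x) k
          by_cases hk : β k ∈ s <;> simp [proj_apply, hk]
        rw [hsplit]
        refine P.add_mem (ht _ fun m hm i hi j hj => ?_) (hs _ fun m hm i hi j hj => ?_)
        · rw [Subalgebra.coe_mul, coe_diagProj, entry_proj_mul]
          split_ifs with his
          · exact hY m ⟨hβ m i hi ▸ his, hm⟩ i hi j hj
          · rfl
        · rw [Subalgebra.coe_mul, coe_diagProj, entry_proj_mul, if_neg]
          intro h
          exact h (show β i ∈ s by rwa [hβ m i hi]) }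
  have hF : ∀ s, s ∈ F ↔ ∀ Y, VanishOn a s Y → Y ∈ P := fun _ => Iff.rfl
  refine ⟨Ultrafilter.ofComplNotMemIff F fun s => ⟨fun hs => ?_, fun hs hsc => ?_⟩, hF⟩
  -- A product of operators vanishing on complementary sets of blocks is strictly block upper
  -- triangular, so primeness decides between `s` and its complement.
  · rcases hP.subset_or_subset (J := VanishOn a s) (K := VanishOn a sᶜ)
      (fun c b hb => ((vanishOn_empty a c).mul hb).mono Set.subset_union_right)
      (fun x y hx hy => haP _ ((hx.mul hy).mono (Set.union_compl_self s).ge)) with h | h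
    · exact h
    · exact absurd h hs
  · have h : (∅ : Set ℕ) ∈ F := by
      rw [← Set.inter_compl_self s]
      exact F.inter_sets hs hsc
    exact hP.one_notMem (h 1 (vanishOn_empty a 1))

/-- Approximation in norm of an operator with small diagonal blocks over `s` by operators whose
blocks over `s` vanish. -/
theorem exists_vanishOn_norm_sub_le {a : ℕ → ℕ} (ha : StrictMono a) (ha0 : a 0 = 0)
    {s : Set ℕ} {δ : ℝ} (hδ : 0 ≤ δ) {X : upperTriangular}
    (hX : ∀ m ∈ s, ‖proj (Set.Ico (a m) (a (m + 1))) * (X : Ell2 →L[ℂ] Ell2) *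
      proj (Set.Ico (a m) (a (m + 1)))‖ ≤ δ) :
    ∃ Y : upperTriangular, VanishOn a s Y ∧ ‖X - Y‖ ≤ δ := by
  classical
  obtain ⟨β, hβ⟩ := exists_blockIndex ha
  have hβ' : ∀ k, k ∈ Set.Ico (a (β k)) (a (β k + 1)) := fun k => by
    obtain ⟨m, hm⟩ := exists_mem_Ico ha ha0 k
    rwa [hβ m k hm]
  -- `Φ` is the direct sum of the diagonal blocks of `X` over `s`, so its norm is at most `δ`;
  -- subtracting it clears these blocks.
  obtain ⟨Φ, hΦn, hΦ⟩ := exists_blockOp β β hδ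
    (fun m => if m ∈ s then proj (Set.Ico (a m) (a (m + 1))) * (X : Ell2 →L[ℂ] Ell2) *
      proj (Set.Ico (a m) (a (m + 1))) else 0) fun m => by
      split_ifs with hm
      · exact hX m hm
      · simpa using hδ
  have hΦe : ∀ i j, entry Φ i j = if β i ∈ s ∧ β j = β i then entry X i j else 0 := by
    intro i j
    rw [entry, hΦ, proj_single]
    by_cases hj : β j = β i
    · by_cases hi : β i ∈ s
      · have h := entry_compress (Set.Ico (a (β i)) (a (β i + 1)))
          (Set.Ico (a (β i)) (a (β i + 1))) X i j
        rw [if_pos ⟨hβ' i, hj ▸ hβ' j⟩] at h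
        rw [if_pos hi, if_pos (show j ∈ β ⁻¹' {β i} from hj), if_pos ⟨hi, hj⟩]
        exact h
      · rw [if_neg hi, if_neg (show ¬(β i ∈ s ∧ β j = β i) from fun h => hi h.1)]
        rfl
    · rw [if_neg (show j ∉ β ⁻¹' {β i} from hj), map_zero,
        if_neg (show ¬(β i ∈ s ∧ β j = β i) from fun h => hj h.2)]
      rfl
  have hΦA : Φ ∈ upperTriangular := mem_upperTriangular_iff_entry.2 fun i j hij => by
    rw [hΦe]
    split_ifs
    · exact mem_upperTriangular_iff_entry.1 X.2 i j hij
    · rfl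
  refine ⟨X - ⟨Φ, hΦA⟩, fun m hm i hi j hj => ?_, ?_⟩
  · change entry ((X : Ell2 →L[ℂ] Ell2) - Φ) i j = 0
    rw [entry_sub, hΦe, hβ m i hi, hβ m j hj, if_pos ⟨hm, rfl⟩, sub_self]
  · rw [sub_sub_cancel]
    exact hΦn

theorem exists_containsLimitIdeal (hP : IsPrimitiveIdeal P)
    (hdiag : ¬ IsDiagonalIdeal canonicalNest P) (hmax : ¬ IsCoatom P) :
    ∃ (𝒰 : Ultrafilter ℕ) (E : ℕ → Ell2 →L[ℂ] Ell2), (𝒰 : Filter ℕ) ≤ cofinite ∧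
      (∀ i, IsInterval canonicalNest (E i)) ∧ ContainsLimitIdeal canonicalNest P 𝒰 E := by
  obtain ⟨a, ha, ha0, haP⟩ := exists_blocks hP hdiag
  obtain ⟨𝒰, h𝒰⟩ := exists_ultrafilter hP ha fun Y hY => haP Y fun m => hY m trivial
  have hint : ∀ i, IsInterval canonicalNest (proj (Set.Ico (a i) (a (i + 1)))) := fun i =>
    isInterval_proj_Ico (ha (Nat.lt_succ_self i))
  have hfin : ∀ i, FiniteDimensional ℂ (proj (Set.Ico (a i) (a (i + 1)))).range := fun i =>
    finiteDimensional_range_proj (Set.finite_Ico _ _)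
  have hcont : ∀ X : upperTriangular, Tendsto (fun i => ‖proj (Set.Ico (a i) (a (i + 1))) *
      (X : Ell2 →L[ℂ] Ell2) * proj (Set.Ico (a i) (a (i + 1)))‖) 𝒰 (𝓝 0) → X ∈ P := by
    intro X hX
    refine hP.mem_of_forall_norm_lt fun ε hε => ?_
    have hs := hX.eventually (gt_mem_nhds (half_pos hε))
    obtain ⟨Y, hY, hXY⟩ := exists_vanishOn_norm_sub_le ha ha0 (half_pos hε).le (X := X)
      (s := {i | _}) fun m hm => le_of_lt hm
    exact ⟨Y, (h𝒰 _).1 hs Y hY, hXY.trans_lt (half_lt_self hε)⟩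
  refine ⟨𝒰, fun i => proj (Set.Ico (a i) (a (i + 1))), ?_, hint, fun i => Or.inl (hint i), hfin,
    fun i j hij => ?_, tendsto_finrank hP hmax (fun i => Set.ordConnected_Ico) hfin hcont, hcont⟩
  · refine 𝒰.le_cofinite_or_eq_pure.resolve_right ?_
    rintro ⟨n, hn⟩
    have hmem : ({n} : Set ℕ) ∈ 𝒰 := by rw [hn]; exact Set.mem_singleton n
    -- A principal ultrafilter would put the complement of one finite block in `P`; the block itself
    -- is in `P`, hence so would be 1.
    have h1 : 1 - diagProj (Set.Ico (a n) (a (n + 1))) ∈ P := by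
      refine (h𝒰 _).1 hmem _ fun m hm i hi j _ => ?_
      obtain rfl : m = n := hm
      change entry (1 - proj (Set.Ico (a m) (a (m + 1)))) i j = 0
      rw [entry_sub, sub_eq_zero, entry, entry, proj_apply_of_mem hi]
      rfl
    have h2 := P.add_mem h1 (diagProj_mem_of_finite hP hdiag (Set.finite_Ico (a n) (a (n + 1))))
    rw [sub_add_cancel] at h2
    exact hP.one_notMem h2
  · change proj _ * proj _ = 0
    rw [proj_mul_proj, ← proj_empty]
    congr 1
    exact Set.disjoint_iff_inter_eq_empty.1 (ha.monotone.pairwise_disjoint_on_Ico_succ hij)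

end Blocks

end NestAlg

theorem mainTheorem11 (P : TwoSidedIdeal NestAlg.upperTriangular)
    (hP : NestAlg.IsPrimitiveIdeal P)
    (hdiag : ¬ NestAlg.IsDiagonalIdeal NestAlg.canonicalNest P)
    (hmax : ¬ IsCoatom P) :
    (∃ (𝒰 : Ultrafilter ℕ) (E : ℕ → NestAlg.Ell2 →L[ℂ] NestAlg.Ell2),
      (𝒰 : Filter ℕ) ≤ Filter.cofinite ∧
      (∀ i, NestAlg.IsInterval NestAlg.canonicalNest (E i)) ∧
      NestAlg.ContainsLimitIdeal NestAlg.canonicalNest P 𝒰 E) ∧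
    (∀ (𝒰 : Ultrafilter ℕ) (E : ℕ → NestAlg.Ell2 →L[ℂ] NestAlg.Ell2),
      (𝒰 : Filter ℕ) ≤ Filter.cofinite →
      NestAlg.ContainsLimitIdeal NestAlg.canonicalNest P 𝒰 E →
      ∀ E₀ E₁ : ℕ → NestAlg.Ell2 →L[ℂ] NestAlg.Ell2,
        (∀ i, NestAlg.IsInterval NestAlg.canonicalNest (E₀ i) ∨ E₀ i = 0) →
        (∀ i, NestAlg.IsInterval NestAlg.canonicalNest (E₁ i) ∨ E₁ i = 0) →
        (∀ i, E i = E₀ i + E₁ i) →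
        NestAlg.ContainsLimitIdeal NestAlg.canonicalNest P 𝒰 E₀ ∨
        NestAlg.ContainsLimitIdeal NestAlg.canonicalNest P 𝒰 E₁) := by
  exact ⟨NestAlg.exists_containsLimitIdeal hP hdiag hmax, fun _ _ _ hE _ _ h₀ h₁ hadd =>
    NestAlg.ContainsLimitIdeal.of_add hP hmax hE h₀ h₁ hadd⟩
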